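/- **L-densities.** An L-density is a symmetric probability measure $c$ on $[-\infty,\infty]$, i.e. $c(-E)=\int_E e^{-x}\,c(dx)$ for Borel $E\not\ni-\infty$. $\Delta_0$ and $\Delta_\infty$ are the unit masses at $0$ and $+\infty$; $H(c)=\int\log_2(1+e^{-y})\,c(dy)$; $\circledast$ and $\boxast$ are the laws of $X+Y$ and of $2\tanh^{-1}(\tanh\frac X2\tanh\frac Y2)$ for independent $X,Y$. **Polar factor graph.** Let $n=2^s$, let $\mathcal A\subseteq\{0,\dots,n-1\}$ be an arbitrary information set, and let $c_0,\dots,c_{n-1}$ be the L-densities of the channels, none of which is $\Delta_0$ (no channel is completely useless). The variable nodes are $(l,w)$ with $0\le l\le s$ and $0\le w<n$; layer $0$ carries the input bits $u_w$, and node $(s,w)$ carries the code bit whose index is the bit reversal of $w$. For $0\le l<s$ and each $w$ whose binary digit of weight $2^l$ is $0$ there are two check nodes: one adjacent to $(l,w),(l+1,w),(l+1,w+2^l)$, and one adjacent to $(l,w+2^l),(l+1,w+2^l)$. The density $c_i$ attached to a variable node $i$ is, for $s\ge1$: the corresponding channel density on layer $s$; $\Delta_\infty$ for a frozen bit $(0,w)$,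 $w\notin\mathcal A$; and $\Delta_0$ for all other nodes. **Message passing.** All messages start as $c_{(i,\alpha)}=c_{(\alpha,i)}=\Delta_0$. Updating a directed edge replaces its density by $c_{(\alpha,i)}=\boxast_{j\in N(\alpha)\setminus i}c_{(j,\alpha)}$, respectively $c_{(i,\alpha)}=c_i\circledast\big(\circledast_{h\in N(i)\setminus\alpha}c_{(h,i)}\big)$, except that an information or frozen bit node $i$ always sends $c_{(i,\alpha)}=\Delta_\infty$ (its bit has been decided). **Successive cancellation (SC)** updates one directed edge at a time, recursively, starting from all nodes of layer $s$. For a block of rows whose layer-$(l+1)$ nodes have received their messages from the channel side, and for every pair of rows $v$, $v'=v+2^l$ in it, with $\alpha$ the degree-3 and $\beta$ the degree-2 check of the pair: 1. update $(l+1,v)\to\alpha$, $(l+1,v')\to\alpha$, $\alpha\to(l,v)$; 2. decode recursively the sub-block of the rows $v$ of layer $l$ (nothing remains to be done if $l=0$: the bit is then decided); 3. feed back $(l,v)\to\alpha$ (hard), then update $\alpha\to(l+1,v')$, $(l+1,v')\to\beta$, $\beta\to(l,v')$; 4. decode recursively the sub-block of the rows $v'$; 5. feed back $(l,v')\to\beta$,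 $\beta\to(l+1,v')$, $(l+1,v')\to\alpha$, $\alpha\to(l+1,v)$ (all hard). The hard messages (decided bits and their partial sums) are not counted; every other edge update is one step. Let $c^{(t)}$ denote the densities after $t$ steps and the hard messages directly following them, and put $$U(\boldsymbol c,t)=-\frac1n\Big\{\sum_iH\big(c_i\circledast(\circledast_{\alpha\in N(i)}c^{(t)}_{(\alpha,i)})\big)+\sum_\alpha\sum_{i\in N(\alpha)}H\big(c^{(t)}_{(i,\alpha)}\big)-\sum_\alpha H\big(\boxast_{i\in N(\alpha)}c^{(t)}_{(i,\alpha)}\big)-\sum_{(i,\alpha)}H\big(c^{(t)}_{(i,\alpha)}\circledast c^{(t)}_{(\alpha,i)}\big)\Big\}.$$ **Statement.** For every step $t\ge1$ of the SC decoder, $U(\boldsymbol c,t)<U(\boldsymbol c,t-1)$ if and only if the directed edge updated in step $t$ is incident to a frozen-bit node $(0,w)$, $w\notin\mathcal A$. -/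

import Mathlib

open MeasureTheory

noncomputable section

namespace PolarGap

/-! ### L-densities -/

/-- The map `x ↦ tanh (x / 2)` from the extended reals to `[-1, 1]`. -/
def tanhHalf : EReal → ℝ
  | ⊥ => -1
  | ⊤ => 1
  | (x : ℝ) => Real.tanh (x / 2)

/-- The inverse map `z ↦ 2 artanh z` from `[-1, 1]` to the extended reals. -/
def twoArtanh (z : ℝ) : EReal :=
  if 1 ≤ z then ⊤ else if z ≤ -1 then ⊥ else ((2 * Real.artanh z : ℝ) : EReal)

/-- The check-node rule on log-likelihood ratios. -/
def checkOp (x y : EReal) : EReal := twoArtanh (tanhHalf x * tanhHalf y)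

theorem measurable_checkOp : Measurable (fun p : EReal × EReal => checkOp p.1 p.2) := by
  have h1 : Measurable tanhHalf := by
    apply EReal.measurable_of_measurable_real
    have : (fun p : ℝ => tanhHalf p) = fun p : ℝ => Real.tanh (p / 2) := rfl
    rw [this]
    simp only [Real.tanh_eq_sinh_div_cosh]
    fun_prop
  have h2 : Measurable twoArtanh := by
    unfold twoArtanh Real.artanh
    refine Measurable.ite measurableSet_Ici measurable_const
      (Measurable.ite measurableSet_Iic measurable_const ?_)
    fun_prop
  exact h2.comp ((h1.comp measurable_fst).mul (h1.comp measurable_snd))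

/-- An L-density: a symmetric probability measure on the extended reals, that is, one with
`c (-E) = ∫_E exp (-x) c(dx)` for all Borel sets `E` that do not contain `-∞`. -/
structure IsLDensity (c : Measure EReal) : Prop where
  isProb : IsProbabilityMeasure c
  symm : ∀ E : Set EReal, MeasurableSet E → ⊥ ∉ E →
    c ((fun x => -x) ⁻¹' E) = ∫⁻ x in E, EReal.exp (-x) ∂c

/-- `Δ_0`, the unit mass at `0`: no information. -/
def delta0 : Measure EReal := Measure.dirac 0

/-- `Δ_∞`, the unit mass at `+∞`: perfect information. -/
def deltaInf : Measure EReal := Measure.dirac ⊤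

/-- The entropy functional `H(c) = ∫ log₂ (1 + exp (-y)) c(dy)`. -/
def entropy (c : Measure EReal) : ℝ :=
  ∫ y, Real.logb 2 (1 + (EReal.exp (-y)).toReal) ∂c

/-- Variable-node convolution: the law of the sum of two independent LLRs. -/
def varConv (μ ν : Measure EReal) : Measure EReal := μ.conv ν

/-- Check-node convolution: the law of `2 artanh (tanh (X / 2) * tanh (Y / 2))` for
independent `X` and `Y`. -/
def checkConv (μ ν : Measure EReal) : Measure EReal :=
  (μ.prod ν).map (fun p => checkOp p.1 p.2)

/-- Iterated variable-node convolution; the neutral element is `Δ_0`. The operation is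
commutative and associative on L-densities, so the order of the list is immaterial. -/
def bigVarConv {ι : Type} (S : Finset ι) (m : ι → Measure EReal) : Measure EReal :=
  S.toList.foldr (fun j acc => varConv (m j) acc) delta0

/-- Iterated check-node convolution; the neutral element is `Δ_∞`. -/
def bigCheckConv {ι : Type} (S : Finset ι) (m : ι → Measure EReal) : Measure EReal :=
  S.toList.foldr (fun j acc => checkConv (m j) acc) deltaInf

/-! ### Message passing on factor graphs -/

/-- A factor graph with variable nodes `V` and check nodes `C`, together with the L-densities
`c_i` of the a priori information on the variables, and the set of those variable nodes
(information and frozen bits of a polar code) whose outgoing message is a hard decision. -/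
structure FactorGraph (V C : Type) where
  nbr : C → Finset V
  chan : V → Measure EReal
  hardSource : Set V

/-- A directed edge of the factor graph. -/
inductive DirEdge (V C : Type)
  | v2c (i : V) (α : C)
  | c2v (α : C) (i : V)

/-- The variable node of a directed edge. -/
def DirEdge.varNode {V C : Type} : DirEdge V C → V
  | .v2c i _ => i
  | .c2v _ i => i

/-- The current L-densities of the messages on all directed edges. -/
structure Messages (V C : Type) where
  v2c : V → C → Measure EReal
  c2v : C → V → Measure EReal

/-- All messages are `Δ_0` at the start. -/
def Messages.init (V C : Type) : Messages V C where
  v2c := fun _ _ => delta0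
  c2v := fun _ _ => delta0

namespace FactorGraph

variable {V C : Type} [Fintype V] [Fintype C] [DecidableEq V] [DecidableEq C]

/-- The check nodes adjacent to a variable node. -/
def varNbr (G : FactorGraph V C) (i : V) : Finset C :=
  Finset.univ.filter (fun α => i ∈ G.nbr α)

open Classical in
/-- The new L-density of the message from `i` to `α`. -/
def newV2C (G : FactorGraph V C) (m : Messages V C) (i : V) (α : C) : Measure EReal :=
  if i ∈ G.hardSource then deltaInf
  else varConv (G.chan i) (bigVarConv ((G.varNbr i).erase α) (fun h => m.c2v h i))

/-- The new L-density of the message from `α` to `i`. -/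
def newC2V (G : FactorGraph V C) (m : Messages V C) (α : C) (i : V) : Measure EReal :=
  bigCheckConv ((G.nbr α).erase i) (fun j => m.v2c j α)

/-- Update the message on one directed edge and leave all the others as they are. -/
def update (G : FactorGraph V C) (m : Messages V C) : DirEdge V C → Messages V C
  | .v2c i α =>
    ⟨Function.update m.v2c i (Function.update (m.v2c i) α (G.newV2C m i α)), m.c2v⟩
  | .c2v α i =>
    ⟨m.v2c, Function.update m.c2v α (Function.update (m.c2v α) i (G.newC2V m α i))⟩

/-- The GAP potential of a family of messages, for code length `N`. -/
def potential (G : FactorGraph V C) (N : ℕ) (m : Messages V C) : ℝ :=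
  -(1 / (N : ℝ)) *
    (∑ i, entropy (varConv (G.chan i) (bigVarConv (G.varNbr i) (fun α => m.c2v α i)))
      + ∑ α, ∑ i ∈ G.nbr α, entropy (m.v2c i α)
      - ∑ α, entropy (bigCheckConv (G.nbr α) (fun i => m.v2c i α))
      - ∑ α, ∑ i ∈ G.nbr α, entropy (varConv (m.v2c i α) (m.c2v α i)))

end FactorGraph

/-! ### The polar factor graph

A word `w : Fin s → Bool` is the number `∑ l, w l * 2 ^ l` in `{0, …, 2 ^ s - 1}`. -/

/-- Variable node `(l, w)`: row `w` of layer `l`. Layer `0` carries the input bits `u` and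
layer `s` the code bits. -/
abbrev VarNode (s : ℕ) : Type := Fin (s + 1) × (Fin s → Bool)

/-- Check node `(l, w)` lies between the layers `l` and `l + 1`. -/
abbrev CheckNode (s : ℕ) : Type := Fin s × (Fin s → Bool)

/-- One butterfly joins the rows `w` and `w + 2 ^ l` (with `w l = false`) of the layers `l` and
`l + 1`: the check `x_l(w) = x_{l+1}(w) + x_{l+1}(w + 2 ^ l)` of degree three, and the check
`x_l(w + 2 ^ l) = x_{l+1}(w + 2 ^ l)` of degree two. -/
def polarNbr (s : ℕ) (a : CheckNode s) : Finset (VarNode s) :=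
  if a.2 a.1 = false then
    {(a.1.castSucc, a.2), (a.1.succ, a.2), (a.1.succ, Function.update a.2 a.1 true)}
  else {(a.1.castSucc, a.2), (a.1.succ, a.2)}

/-- A priori L-densities for the information set `A`: `Δ_∞` on frozen bits, nothing on
information bits and hidden nodes; on layer `s` the L-densities of the channels, in
bit-reversed order. -/
def polarChan (s : ℕ) (A : Finset (Fin s → Bool)) (c : (Fin s → Bool) → Measure EReal)
    (i : VarNode s) : Measure EReal :=
  if i.1 = 0 then (if i.2 ∈ A then delta0 else deltaInf)
  else if i.1 = Fin.last s then c (fun l => i.2 l.rev)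
  else delta0

/-- The factor graph of the polar code of length `2 ^ s` with information set `A`. -/
def polarGraph (s : ℕ) (A : Finset (Fin s → Bool)) (c : (Fin s → Bool) → Measure EReal) :
    FactorGraph (VarNode s) (CheckNode s) where
  nbr := polarNbr s
  chan := polarChan s A c
  hardSource := {i | i.1 = 0}

/-- The node of an input bit that is frozen. -/
def IsFrozenNode {s : ℕ} (A : Finset (Fin s → Bool)) (i : VarNode s) : Prop :=
  i.1 = 0 ∧ i.2 ∉ A

/-! ### Successive-cancellation decoding as a schedule -/

/-- A scheduled message; `hard` marks decided bits and their partial sums, which are fed back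
and do not count as messages passed. -/
structure Scheduled (s : ℕ) where
  edge : DirEdge (VarNode s) (CheckNode s)
  hard : Bool

/-- The message from node `(l, i)` to check `(l, a)`, on the side of the input bits. -/
def fromLeft {s : ℕ} (hard : Bool) (l : Fin s) (i a : Fin s → Bool) : Scheduled s :=
  ⟨.v2c (l.castSucc, i) (l, a), hard⟩

/-- The message from check `(l, a)` to node `(l, i)`. -/
def toLeft {s : ℕ} (hard : Bool) (l : Fin s) (a i : Fin s → Bool) : Scheduled s :=
  ⟨.c2v (l, a) (l.castSucc, i), hard⟩

/-- The message from node `(l + 1, i)` to check `(l, a)`, on the side of the channel. -/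
def fromRight {s : ℕ} (hard : Bool) (l : Fin s) (i a : Fin s → Bool) : Scheduled s :=
  ⟨.v2c (l.succ, i) (l, a), hard⟩

/-- The message from check `(l, a)` to node `(l + 1, i)`. -/
def toRight {s : ℕ} (hard : Bool) (l : Fin s) (a i : Fin s → Bool) : Scheduled s :=
  ⟨.c2v (l, a) (l.succ, i), hard⟩

/-- The words that agree with `w` in all positions `≥ l`, in increasing order. -/
def subcube {s : ℕ} : (l : ℕ) → l ≤ s → (Fin s → Bool) → List (Fin s → Bool)
  | 0, _, w => [w]
  | l + 1, h, w =>
    subcube l (Nat.le_of_succ_le h) (Function.update w ⟨l, h⟩ false) ++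
      subcube l (Nat.le_of_succ_le h) (Function.update w ⟨l, h⟩ true)

/-- Successive cancellation on the input bits `u_v`, `v ∈ subcube l w`, given the LLRs at the
nodes of layer `l` in these rows. For `l + 1`: the `F` functions produce the LLRs of
the rows with `v l = false` of layer `l`; the bits that belong to them are decoded recursively;
their partial sums are fed back, and the `G` functions produce the LLRs of the rows with
`v l = true`; the bits that belong to these are decoded; the partial sums are
fed back to layer `l + 1`. -/
def scSchedule {s : ℕ} : (l : ℕ) → l ≤ s → (Fin s → Bool) → List (Scheduled s)
  | 0, _, _ => []
  | l + 1, h, w =>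
    let k : Fin s := ⟨l, h⟩
    let h0 : l ≤ s := Nat.le_of_succ_le h
    let up : (Fin s → Bool) → (Fin s → Bool) := fun v => Function.update v k true
    let rows := subcube l h0 (Function.update w k false)
    rows.flatMap (fun v =>
        [fromRight false k v v, fromRight false k (up v) v, toLeft false k v v])
      ++ scSchedule l h0 (Function.update w k false)
      ++ rows.flatMap (fun v =>
        [fromLeft true k v v, toRight false k v (up v),
          fromRight false k (up v) (up v), toLeft false k (up v) (up v)])
      ++ scSchedule l h0 (Function.update w k true)
      ++ rows.flatMap (fun v =>
        [fromLeft true k (up v) (up v), toRight true k (up v) (up v),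
          fromRight true k (up v) v, toRight true k v v])

/-- The complete schedule of the successive-cancellation decoder. -/
def scFull (s : ℕ) : List (Scheduled s) := scSchedule s le_rfl (fun _ => false)

/-- The directed edges that are updated in the counted steps `1, 2, …` of the decoder. -/
def scSteps (s : ℕ) : List (DirEdge (VarNode s) (CheckNode s)) :=
  ((scFull s).filter (fun e => !e.hard)).map (fun e => e.edge)

/-- Run a schedule until `t` messages have been passed; hard messages are not counted, and those
that follow the `t`-th counted message at once are included. -/
def run {s : ℕ} (G : FactorGraph (VarNode s) (CheckNode s)) :
    List (Scheduled s) → ℕ → Messages (VarNode s) (CheckNode s) →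
      Messages (VarNode s) (CheckNode s)
  | [], _, m => m
  | ⟨e, true⟩ :: L, t, m => run G L t (G.update m e)
  | ⟨_, false⟩ :: _, 0, m => m
  | ⟨e, false⟩ :: L, t + 1, m => run G L t (G.update m e)

/-- `U(c, t)` for successive-cancellation decoding of the polar code with information set `A`:
the GAP after `t` messages have been passed. -/
def gap {s : ℕ} (A : Finset (Fin s → Bool)) (c : (Fin s → Bool) → Measure EReal) (t : ℕ) : ℝ :=
  (polarGraph s A c).potential (2 ^ s)
    (run (polarGraph s A c) (scFull s) t (Messages.init (VarNode s) (CheckNode s)))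

end PolarGap

end

noncomputable section

namespace PolarGap

set_option linter.unusedSectionVars false

/-! ### The hyperbolic tangent coordinate -/

/-! Updating one directed edge changes only the few terms of the potential that contain its message,
and the change is governed by the opposite message on the same edge.

For a message from a check `α` to a variable `i`, the terms involved are the entropy at `i` and the
edge entropy. The first is H(c_{αi} ⊛ b), with b the message that `i` would send to `α` now; the
second is H(c_{αi} ⊛ c_{iα}). They cancel if the stored message c_{iα} equals b
(`potential_update_c2v_eq`).

For a message from `i` to `α`, the duality H(a ⊛ b) + H(a ⊡ b) = H(a) + H(b), where ⊡ is the check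
convolution, shows that the potential is unchanged if the stored c_{αi} is what `α` would send now.
The new value of c_{iα} is then irrelevant (`potential_update_v2c_eq`), so hard decisions cost
nothing.

In the SC schedule the opposite message is always up to date in this sense, with one exception. When
the last check writes to a frozen node, that node has so far sent Δ_0, although its prior Δ_∞ would
make it send Δ_∞. The entropy at the node stays 0 and the edge entropy drops from 1 to the entropy
of the new message, so the potential falls strictly as soon as that entropy is below 1
(`potential_update_c2v_lt`). A symmetric measure other than Δ_0 has entropy below 1, and it charges
the positive LLRs; this last property propagates from the channels through both convolutions.

The combinatorial half checks that the opposite message is up to date along the schedule. Each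
butterfly passes through the stages `Stage0`, `Stage1`, `Stage2` (`run_F`, `run_G`, `run_feedback`).
Distinct butterflies and sub-blocks do not disturb each other, because they write at different check
nodes (`AgreeOn`, `goodRun_flatMap`). `goodRun_scSchedule` assembles this by induction on the layer.
-/

@[simp] theorem tanhHalf_bot : tanhHalf ⊥ = -1 := rfl
@[simp] theorem tanhHalf_top : tanhHalf ⊤ = 1 := rfl
@[simp] theorem tanhHalf_coe (x : ℝ) : tanhHalf (x : EReal) = Real.tanh (x / 2) := rfl
@[simp] theorem tanhHalf_zero : tanhHalf 0 = 0 := by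
  rw [← EReal.coe_zero, tanhHalf_coe]; simp

theorem measurable_tanhHalf : Measurable tanhHalf := by
  apply EReal.measurable_of_measurable_real
  have : (fun p : ℝ => tanhHalf p) = fun p : ℝ => Real.tanh (p / 2) := rfl
  rw [this]
  simp only [Real.tanh_eq_sinh_div_cosh]
  fun_prop

theorem tanhHalf_coe_mem (x : ℝ) : tanhHalf (x : EReal) ∈ Set.Ioo (-1 : ℝ) 1 :=
  Real.tanh_bijOn.mapsTo (Set.mem_univ (x / 2))

theorem neg_one_le_tanhHalf (x : EReal) : -1 ≤ tanhHalf x := by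
  induction x with
  | bot => simp
  | top => simp
  | coe x => exact (tanhHalf_coe_mem x).1.le

theorem tanhHalf_le_one (x : EReal) : tanhHalf x ≤ 1 := by
  induction x with
  | bot => simp
  | top => simp
  | coe x => exact (tanhHalf_coe_mem x).2.le

theorem neg_one_lt_tanhHalf {x : EReal} (hx : x ≠ ⊥) : -1 < tanhHalf x := by
  induction x with
  | bot => exact absurd rfl hx
  | top => simp
  | coe x => exact (tanhHalf_coe_mem x).1

theorem tanhHalf_lt_one {x : EReal} (hx : x ≠ ⊤) : tanhHalf x < 1 := by
  induction x with
  | bot => simp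
  | top => exact absurd rfl hx
  | coe x => exact (tanhHalf_coe_mem x).2

theorem tanhHalf_neg (x : EReal) : tanhHalf (-x) = -tanhHalf x := by
  induction x with
  | bot => simp
  | top => simp
  | coe x => rw [← EReal.coe_neg, tanhHalf_coe, tanhHalf_coe, neg_div, Real.tanh_neg]

theorem twoArtanh_tanhHalf (x : EReal) : twoArtanh (tanhHalf x) = x := by
  induction x with
  | bot => norm_num [twoArtanh]
  | top => simp [twoArtanh]
  | coe x =>
    have h := tanhHalf_coe_mem x
    rw [twoArtanh, if_neg (not_le.2 h.2), if_neg (not_le.2 h.1), tanhHalf_coe, Real.artanh_tanh]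
    congr 1; ring

theorem tanhHalf_twoArtanh {z : ℝ} (h1 : -1 ≤ z) (h2 : z ≤ 1) : tanhHalf (twoArtanh z) = z := by
  unfold twoArtanh
  split_ifs with h h'
  · simp; linarith
  · simp; linarith
  · rw [tanhHalf_coe, mul_div_cancel_left₀ _ two_ne_zero,
      Real.tanh_artanh ⟨not_le.1 h', not_le.1 h⟩]

/-- In the tanh coordinate `checkOp` is multiplication and negation is a change of sign, so
injectivity reduces identities for `checkOp` to ring identities. -/
theorem tanhHalf_injective : Function.Injective tanhHalf :=
  Function.LeftInverse.injective twoArtanh_tanhHalf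

theorem tanhHalf_checkOp (x y : EReal) : tanhHalf (checkOp x y) = tanhHalf x * tanhHalf y := by
  have hx := abs_le.2 ⟨neg_one_le_tanhHalf x, tanhHalf_le_one x⟩
  have hy := abs_le.2 ⟨neg_one_le_tanhHalf y, tanhHalf_le_one y⟩
  have h : |tanhHalf x * tanhHalf y| ≤ 1 := by
    rw [abs_mul]; exact mul_le_one₀ hx (abs_nonneg _) hy
  exact tanhHalf_twoArtanh (abs_le.1 h).1 (abs_le.1 h).2

theorem checkOp_neg_left (x y : EReal) : checkOp (-x) y = -checkOp x y :=
  tanhHalf_injective (by simp only [tanhHalf_checkOp, tanhHalf_neg]; ring)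

theorem checkOp_neg_right (x y : EReal) : checkOp x (-y) = -checkOp x y :=
  tanhHalf_injective (by simp only [tanhHalf_checkOp, tanhHalf_neg]; ring)

theorem checkOp_left_comm (x y z : EReal) :
    checkOp x (checkOp y z) = checkOp y (checkOp x z) :=
  tanhHalf_injective (by simp only [tanhHalf_checkOp]; ring)

theorem checkOp_zero_left (x : EReal) : checkOp 0 x = 0 :=
  tanhHalf_injective (by simp [tanhHalf_checkOp])

theorem exp_neg_eq_tanh (x : ℝ) :
    Real.exp (-x) = (1 - Real.tanh (x / 2)) / (1 + Real.tanh (x / 2)) := by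
  have h := (tanhHalf_coe_mem x).1
  rw [tanhHalf_coe] at h
  rw [eq_div_iff (by linarith), Real.tanh_eq_sinh_div_cosh, Real.sinh_eq, Real.cosh_eq]
  have h3 : Real.exp (-x) = Real.exp (-(x / 2)) * Real.exp (-(x / 2)) := by
    rw [← Real.exp_add]; congr 1; ring
  have h4 : Real.exp (x / 2) * Real.exp (-(x / 2)) = 1 := by
    rw [← Real.exp_add]; simp
  have := Real.exp_pos (x / 2)
  have := Real.exp_pos (-(x / 2))
  rw [h3]
  field_simp
  linear_combination (2 * Real.exp (-(x / 2))) * h4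

theorem exp_neg_eq_tanhHalf {x : EReal} (hx : x ≠ ⊥) :
    EReal.exp (-x) = ENNReal.ofReal ((1 - tanhHalf x) / (1 + tanhHalf x)) := by
  induction x with
  | bot => exact absurd rfl hx
  | top => simp
  | coe x => rw [← EReal.coe_neg, EReal.exp_coe, exp_neg_eq_tanh, tanhHalf_coe]

theorem toReal_exp_neg {x : EReal} (hx : x ≠ ⊥) :
    (EReal.exp (-x)).toReal = (1 - tanhHalf x) / (1 + tanhHalf x) := by
  rw [exp_neg_eq_tanhHalf hx, ENNReal.toReal_ofReal]
  have := neg_one_lt_tanhHalf hx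
  have := tanhHalf_le_one x
  apply div_nonneg <;> linarith

theorem tanhHalf_add {x y : EReal} (hx : x ≠ ⊥) (hy : y ≠ ⊥) :
    tanhHalf (x + y) * (1 + tanhHalf x * tanhHalf y) = tanhHalf x + tanhHalf y := by
  induction x with
  | bot => exact absurd rfl hx
  | top => rw [EReal.top_add_of_ne_bot hy]; simp
  | coe x =>
    induction y with
    | bot => exact absurd rfl hy
    | top => rw [EReal.coe_add_top]; simp; ring
    | coe y =>
      have hz : x / 2 + y / 2 = (x + y) / 2 := by ring
      rw [← EReal.coe_add, tanhHalf_coe, tanhHalf_coe, tanhHalf_coe, ← hz]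
      simp only [Real.tanh_eq_sinh_div_cosh]
      have h1 := Real.cosh_pos (x / 2)
      have h2 := Real.cosh_pos (y / 2)
      have h3 := Real.cosh_pos (x / 2 + y / 2)
      field_simp
      rw [← hz, Real.sinh_add, Real.cosh_add]; ring

theorem one_add_tanhHalf_mul_pos {x y : EReal} (hx : x ≠ ⊥) (hy : y ≠ ⊥) :
    0 < 1 + tanhHalf x * tanhHalf y := by
  have h1 := neg_one_lt_tanhHalf hx
  have h2 := neg_one_lt_tanhHalf hy
  have h3 := tanhHalf_le_one x
  have h4 := tanhHalf_le_one y
  rcases le_or_gt 0 (tanhHalf x) with h | h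
  · nlinarith
  · nlinarith

theorem tanhHalf_pos_iff {x : EReal} : 0 < tanhHalf x ↔ 0 < x := by
  induction x with
  | bot => simp
  | top => simp
  | coe x =>
    rw [tanhHalf_coe, Real.tanh_eq_sinh_div_cosh, EReal.coe_pos,
      div_pos_iff_of_pos_right (Real.cosh_pos _), Real.sinh_pos_iff]
    constructor <;> intro h <;> linarith

theorem checkOp_pos {x y : EReal} (hx : 0 < x) (hy : 0 < y) : 0 < checkOp x y := by
  rw [← tanhHalf_pos_iff, tanhHalf_checkOp]
  exact mul_pos (tanhHalf_pos_iff.2 hx) (tanhHalf_pos_iff.2 hy)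

theorem checkOp_ne_bot {x y : EReal} (hx : x ≠ ⊥) (hy : y ≠ ⊥) : checkOp x y ≠ ⊥ := by
  intro h
  have h1 := one_add_tanhHalf_mul_pos hx hy
  rw [← tanhHalf_checkOp, h] at h1
  simp at h1

/-! ### The entropy kernel -/

/-- The integrand of the entropy functional. -/
def entropyKernel (x : EReal) : ℝ := Real.logb 2 (1 + (EReal.exp (-x)).toReal)

theorem measurable_exp_neg : Measurable (fun x : EReal => EReal.exp (-x)) :=
  EReal.exp_monotone.measurable.comp continuous_neg.measurable

theorem measurable_entropyKernel : Measurable entropyKernel := by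
  unfold entropyKernel Real.logb
  have := measurable_exp_neg
  fun_prop

theorem entropyKernel_nonneg (x : EReal) : 0 ≤ entropyKernel x :=
  Real.logb_nonneg one_lt_two (by simp)

/-- With z = tanh(x/2) one has exp(-x) = (1 - z)/(1 + z), hence 1 + exp(-x) = 2/(1 + z). -/
theorem entropyKernel_eq {x : EReal} (hx : x ≠ ⊥) :
    entropyKernel x = 1 - Real.logb 2 (1 + tanhHalf x) := by
  have h := neg_one_lt_tanhHalf hx
  have h2 : 1 + (1 - tanhHalf x) / (1 + tanhHalf x) = 2 / (1 + tanhHalf x) := by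
    have : 1 + tanhHalf x ≠ 0 := by linarith
    field_simp; ring
  rw [entropyKernel, toReal_exp_neg hx, h2, Real.logb_div two_ne_zero (by linarith),
    Real.logb_self_eq_one one_lt_two]

/-- The pointwise form of the duality. If z, z' and z'' are the tanh coordinates of x, y and x + y,
the addition theorem gives (1 + z'')(1 + z z') = (1 + z)(1 + z'); take logarithms. -/
theorem entropyKernel_add_checkOp {x y : EReal} (hx : x ≠ ⊥) (hy : y ≠ ⊥) :
    entropyKernel (x + y) + entropyKernel (checkOp x y) = entropyKernel x + entropyKernel y := by
  have hxy : x + y ≠ ⊥ := by simp [EReal.add_eq_bot_iff, hx, hy]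
  have hc := checkOp_ne_bot hx hy
  have h1 := neg_one_lt_tanhHalf hx
  have h2 := neg_one_lt_tanhHalf hy
  have h3 := neg_one_lt_tanhHalf hxy
  have h4 := one_add_tanhHalf_mul_pos hx hy
  rw [entropyKernel_eq hxy, entropyKernel_eq hc, entropyKernel_eq hx, entropyKernel_eq hy,
    tanhHalf_checkOp]
  have : Real.logb 2 (1 + tanhHalf (x + y)) + Real.logb 2 (1 + tanhHalf x * tanhHalf y) =
      Real.logb 2 (1 + tanhHalf x) + Real.logb 2 (1 + tanhHalf y) := by
    rw [← Real.logb_mul (by linarith) h4.ne', ← Real.logb_mul (by linarith) (by linarith)]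
    congr 1
    linear_combination tanhHalf_add hx hy
  linarith

/-! ### Laws of binary operations -/

/-- The law of `op X Y` for independent `X` and `Y`. -/
def opConv (op : EReal → EReal → EReal) (μ ν : Measure EReal) : Measure EReal :=
  (μ.prod ν).map (fun p => op p.1 p.2)

theorem varConv_eq_opConv : varConv = opConv (fun x y => x + y) := rfl

theorem checkConv_eq_opConv : checkConv = opConv checkOp := rfl

theorem measurable_addOp : Measurable (fun p : EReal × EReal => p.1 + p.2) := measurable_add

section opConv

variable {op : EReal → EReal → EReal}

theorem lintegral_opConv (hop : Measurable (fun p : EReal × EReal => op p.1 p.2))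
    (μ ν : Measure EReal) [SFinite ν] {f : EReal → ENNReal} (hf : Measurable f) :
    ∫⁻ x, f x ∂(opConv op μ ν) = ∫⁻ x, ∫⁻ y, f (op x y) ∂ν ∂μ := by
  have h : Measurable (fun p : EReal × EReal => f (op p.1 p.2)) := hf.comp hop
  rw [opConv, lintegral_map hf hop, lintegral_prod _ h.aemeasurable]

theorem isProbabilityMeasure_opConv (hop : Measurable (fun p : EReal × EReal => op p.1 p.2))
    (μ ν : Measure EReal) [IsProbabilityMeasure μ] [IsProbabilityMeasure ν] :
    IsProbabilityMeasure (opConv op μ ν) :=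
  Measure.isProbabilityMeasure_map hop.aemeasurable

/-- Tonelli. Left commutativity is the only law needed to permute the factors of a right fold. -/
theorem opConv_left_comm (hop : Measurable (fun p : EReal × EReal => op p.1 p.2))
    (hcomm : ∀ x y z, op x (op y z) = op y (op x z))
    (μ ν ρ : Measure EReal) [IsProbabilityMeasure μ] [IsProbabilityMeasure ν]
    [IsProbabilityMeasure ρ] :
    opConv op μ (opConv op ν ρ) = opConv op ν (opConv op μ ρ) := by
  have := isProbabilityMeasure_opConv hop ν ρ
  have := isProbabilityMeasure_opConv hop μ ρ
  refine Measure.ext_of_lintegral _ fun f hf => ?_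
  have hx : ∀ x, Measurable (fun y => f (op x y)) := fun x =>
    (hf.comp hop).comp measurable_prodMk_left
  rw [lintegral_opConv hop _ _ hf, lintegral_opConv hop _ _ hf]
  simp_rw [lintegral_opConv hop _ _ (hx _)]
  rw [lintegral_lintegral_swap]
  · simp_rw [hcomm]
  · have h1 : Measurable (fun p : (EReal × EReal) × EReal => op p.1.1 (op p.1.2 p.2)) :=
      hop.comp ((measurable_fst.comp measurable_fst).prodMk
        (hop.comp ((measurable_snd.comp measurable_fst).prodMk measurable_snd)))
    exact (Measurable.lintegral_prod_right' (hf.comp h1)).aemeasurable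

end opConv

/-! ### Symmetric measures -/

/-- The weight `1 - tanh (x / 2)`; a measure is symmetric if its density with respect to this
weight is even. -/
def symWeight (x : EReal) : ENNReal := ENNReal.ofReal (1 - tanhHalf x)

theorem measurable_symWeight : Measurable symWeight :=
  (measurable_const.sub measurable_tanhHalf).ennreal_ofReal

/-- Symmetric probability measures, characterised by test functions. -/
structure IsSym (c : Measure EReal) : Prop where
  isProb : IsProbabilityMeasure c
  symm : ∀ g : EReal → ENNReal, Measurable g →
    ∫⁻ x, g (-x) * symWeight x ∂c = ∫⁻ x, g x * symWeight x ∂c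

/-- Away from -∞ the reflected measure has density exp(-x) = (1 - z)/(1 + z), z = tanh(x/2).
Multiplying by 1 + z clears the denominator and gives a condition without an exceptional point. -/
theorem IsLDensity.isSym {c : Measure EReal} (h : IsLDensity c) : IsSym c := by
  have hneg : Measurable (fun x : EReal => -x) := continuous_neg.measurable
  have hbot : c {⊥} = 0 := by
    -- On {⊤} the density exp(-x) vanishes, so the reflected point ⊥ has no mass.
    have := h.symm {⊤} (measurableSet_singleton _) (by simp)
    have h2 : ((fun x : EReal => -x) ⁻¹' {⊤}) = {⊥} := by
      ext x; simp
    rw [h2] at this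
    simpa using this
  have hae : ∀ᵐ x ∂c, x ∈ ({⊥}ᶜ : Set EReal) := by
    rw [ae_iff]; simpa using hbot
  have hm : (c.map (fun x => -x)).restrict {⊥}ᶜ =
      (c.restrict {⊥}ᶜ).withDensity (fun x => EReal.exp (-x)) := by
    ext E hE
    have hE' : MeasurableSet (E ∩ {⊥}ᶜ) := hE.inter (measurableSet_singleton _).compl
    rw [Measure.restrict_apply hE, Measure.map_apply hneg hE', h.symm _ hE' (by simp),
      withDensity_apply _ hE, Measure.restrict_restrict hE]
  refine ⟨h.isProb, fun g hg => ?_⟩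
  have hF : Measurable (fun x => g x * ENNReal.ofReal (1 + tanhHalf x)) :=
    hg.mul (measurable_const.add measurable_tanhHalf).ennreal_ofReal
  calc ∫⁻ x, g (-x) * symWeight x ∂c
      = ∫⁻ x, g x * ENNReal.ofReal (1 + tanhHalf x) ∂(c.map (fun x => -x)) := by
        rw [lintegral_map hF hneg]
        simp_rw [tanhHalf_neg, symWeight, sub_eq_add_neg]
    -- The point ⊥ may be dropped even if the reflected measure charges it, since 1 + tanh(x/2) is 0
    -- there.
    _ = ∫⁻ x in {⊥}ᶜ, g x * ENNReal.ofReal (1 + tanhHalf x) ∂(c.map (fun x => -x)) := by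
        rw [← lintegral_indicator (measurableSet_singleton _).compl]
        refine lintegral_congr fun x => ?_
        by_cases hx : x = ⊥
        · simp [hx]
        · rw [Set.indicator_of_mem hx]
    _ = ∫⁻ x in {⊥}ᶜ, g x * symWeight x ∂c := by
        rw [hm, lintegral_withDensity_eq_lintegral_mul _ measurable_exp_neg hF]
        refine setLIntegral_congr_fun (measurableSet_singleton _).compl fun x hx => ?_
        have hz := neg_one_lt_tanhHalf hx
        have hz' : 0 < 1 + tanhHalf x := by linarith
        have hz1 := tanhHalf_le_one x
        have : ENNReal.ofReal ((1 - tanhHalf x) / (1 + tanhHalf x)) *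
            ENNReal.ofReal (1 + tanhHalf x) = ENNReal.ofReal (1 - tanhHalf x) := by
          rw [← ENNReal.ofReal_mul (div_nonneg (by linarith) hz'.le), div_mul_cancel₀ _ hz'.ne']
        rw [Pi.mul_apply, exp_neg_eq_tanhHalf hx, symWeight, ← this]
        ring
    _ = ∫⁻ x, g x * symWeight x ∂c := by
        rw [Measure.restrict_eq_self_of_ae_mem hae]

theorem isSym_delta0 : IsSym delta0 := by
  refine ⟨by unfold delta0; infer_instance, fun g hg => ?_⟩
  simp [delta0]

theorem isSym_deltaInf : IsSym deltaInf := by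
  refine ⟨by unfold deltaInf; infer_instance, fun g hg => ?_⟩
  simp [deltaInf, symWeight]

/-- Test with the indicator of ⊥: its reflection lives at ⊤, where the weight is 0, while the weight
at ⊥ is 2. -/
theorem IsSym.ae_ne_bot {c : Measure EReal} (h : IsSym c) : ∀ᵐ x ∂c, x ≠ ⊥ := by
  have hs := h.symm (Set.indicator {⊥} 1) (measurable_one.indicator (measurableSet_singleton _))
  have h1 : ∀ x : EReal, Set.indicator {⊥} (1 : EReal → ENNReal) (-x) * symWeight x = 0 := by
    intro x
    by_cases hx : x = ⊤
    · simp [hx, symWeight]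
    · have : -x ∉ ({⊥} : Set EReal) := by simpa using hx
      simp [Set.indicator_of_notMem this]
  have hm : Measurable (fun x => Set.indicator {⊥} (1 : EReal → ENNReal) x * symWeight x) :=
    (measurable_one.indicator (measurableSet_singleton _)).mul measurable_symWeight
  simp_rw [h1, lintegral_zero] at hs
  rw [eq_comm, lintegral_eq_zero_iff hm] at hs
  filter_upwards [hs] with x hx hb
  subst hb
  norm_num [symWeight] at hx

theorem IsSym.opConv_of_ae {op : EReal → EReal → EReal} {a b : Measure EReal}
    (hop : Measurable (fun p : EReal × EReal => op p.1 p.2)) (ha : IsSym a) (hb : IsSym b)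
    (h : ∀ g : EReal → ENNReal, Measurable g →
      ∫⁻ x, ∫⁻ y, g (-op x y) * symWeight (op x y) ∂b ∂a =
        ∫⁻ x, ∫⁻ y, g (op x y) * symWeight (op x y) ∂b ∂a) : IsSym (opConv op a b) := by
  have := ha.isProb
  have := hb.isProb
  refine ⟨isProbabilityMeasure_opConv hop a b, fun g hg => ?_⟩
  have h1 : Measurable (fun x => g (-x) * symWeight x) :=
    (hg.comp continuous_neg.measurable).mul measurable_symWeight
  have h2 : Measurable (fun x => g x * symWeight x) := hg.mul measurable_symWeight
  rw [lintegral_opConv hop _ _ h1, lintegral_opConv hop _ _ h2]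
  exact h g hg

/-- Reflection in both variables of a weighted double integral. -/
theorem IsSym.lintegral_lintegral_neg {a b : Measure EReal} (ha : IsSym a) (hb : IsSym b)
    {F : EReal → EReal → ENNReal} (hF : Measurable (Function.uncurry F)) :
    ∫⁻ x, (∫⁻ y, F (-x) (-y) * symWeight y ∂b) * symWeight x ∂a =
      ∫⁻ x, (∫⁻ y, F x y * symWeight y ∂b) * symWeight x ∂a := by
  have := hb.isProb
  have hFx : ∀ x, Measurable (F x) := fun x => hF.comp measurable_prodMk_left
  simp_rw [fun x => hb.symm (F (-x)) (hFx (-x))]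
  refine ha.symm (fun x => ∫⁻ y, F x y * symWeight y ∂b) ?_
  exact Measurable.lintegral_prod_right'
    (f := fun p : EReal × EReal => F p.1 p.2 * symWeight p.2)
    (hF.mul (measurable_symWeight.comp measurable_snd))

/-- The weight of x + y is the product of the weights of x and y divided by 1 + tanh(x/2) tanh(y/2).
The denominator, absorbed into the kernel `k`, does not change when both variables are reflected. -/
theorem IsSym.varConv {a b : Measure EReal} (ha : IsSym a) (hb : IsSym b) :
    IsSym (varConv a b) := by
  have := ha.isProb
  have := hb.isProb
  rw [varConv_eq_opConv]
  refine IsSym.opConv_of_ae measurable_addOp ha hb fun g hg => ?_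
  set k : EReal → EReal → ENNReal :=
    fun x y => (ENNReal.ofReal (1 + tanhHalf x * tanhHalf y))⁻¹ with hk
  have hkm : Measurable (Function.uncurry k) := by
    have h1 : Measurable (fun p : EReal × EReal => tanhHalf p.1) :=
      measurable_tanhHalf.comp measurable_fst
    have h2 : Measurable (fun p : EReal × EReal => tanhHalf p.2) :=
      measurable_tanhHalf.comp measurable_snd
    exact ((measurable_const.add (h1.mul h2)).ennreal_ofReal).inv
  have hw : ∀ x y : EReal, x ≠ ⊥ → y ≠ ⊥ →
      symWeight (x + y) = k x y * symWeight y * symWeight x := by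
    intro x y hx hy
    have h4 := one_add_tanhHalf_mul_pos hx hy
    have h5 := tanhHalf_le_one x
    have h6 := tanhHalf_le_one y
    simp only [hk, symWeight]
    rw [← ENNReal.ofReal_inv_of_pos h4, ← ENNReal.ofReal_mul (by positivity),
      ← ENNReal.ofReal_mul (mul_nonneg (by positivity) (by linarith))]
    congr 1
    have := tanhHalf_add hx hy
    field_simp
    linear_combination -this
  have hneg : ∀ x y : EReal, x ≠ ⊥ → y ≠ ⊥ →
      g (-(x + y)) * symWeight (x + y) = g (-x + -y) * k (-x) (-y) * symWeight y * symWeight x := by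
    intro x y hx hy
    have hkk : k (-x) (-y) = k x y := by simp [hk, tanhHalf_neg]
    rw [hw x y hx hy, hkk, EReal.neg_add (Or.inl hx) (Or.inr hy), sub_eq_add_neg]
    ring
  have hpos : ∀ x y : EReal, x ≠ ⊥ → y ≠ ⊥ →
      g (x + y) * symWeight (x + y) = g (x + y) * k x y * symWeight y * symWeight x := by
    intro x y hx hy
    rw [hw x y hx hy]
    ring
  have hFm : Measurable (Function.uncurry fun x y => g (x + y) * k x y) :=
    (hg.comp measurable_addOp).mul hkm
  have key := ha.lintegral_lintegral_neg hb hFm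
  have hmy : ∀ x, Measurable fun y => g (x + y) * k x y * symWeight y := fun x =>
    (hFm.comp measurable_prodMk_left).mul measurable_symWeight
  have hmy' : ∀ x, Measurable fun y => g (-x + -y) * k (-x) (-y) * symWeight y := fun x =>
    ((hFm.comp (measurable_prodMk_left (x := -x))).comp
      continuous_neg.measurable).mul measurable_symWeight
  calc _ = ∫⁻ x, (∫⁻ y, g (-x + -y) * k (-x) (-y) * symWeight y ∂b) * symWeight x ∂a := by
        refine lintegral_congr_ae ?_
        filter_upwards [ha.ae_ne_bot] with x hx
        rw [← lintegral_mul_const _ (hmy' x)]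
        refine lintegral_congr_ae ?_
        filter_upwards [hb.ae_ne_bot] with y hy
        exact hneg x y hx hy
    _ = _ := key
    _ = _ := by
        refine lintegral_congr_ae ?_
        filter_upwards [ha.ae_ne_bot] with x hx
        rw [← lintegral_mul_const _ (hmy x)]
        refine lintegral_congr_ae ?_
        filter_upwards [hb.ae_ne_bot] with y hy
        exact (hpos x y hx hy).symm

/-- Here 1 - z z' = ((1 + z')(1 - z) + (1 + z)(1 - z'))/2. Reflecting either argument of `checkOp`
reflects the result, so symmetry in x alone treats the first summand and symmetry in y alone the
second. -/
theorem IsSym.checkConv {a b : Measure EReal} (ha : IsSym a) (hb : IsSym b) :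
    IsSym (checkConv a b) := by
  have := ha.isProb
  have := hb.isProb
  rw [checkConv_eq_opConv]
  refine IsSym.opConv_of_ae measurable_checkOp ha hb fun g hg => ?_
  set p : EReal → ENNReal := fun x => ENNReal.ofReal (1 + tanhHalf x) with hp
  have hpm : Measurable p := (measurable_const.add measurable_tanhHalf).ennreal_ofReal
  have hw : ∀ x y : EReal, symWeight (checkOp x y) =
      2⁻¹ * (p y * symWeight x) + 2⁻¹ * (p x * symWeight y) := by
    intro x y
    have h1 := tanhHalf_le_one x
    have h2 := tanhHalf_le_one y
    have h3 := neg_one_le_tanhHalf x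
    have h4 := neg_one_le_tanhHalf y
    have h5 : (2⁻¹ : ENNReal) = ENNReal.ofReal 2⁻¹ := by
      rw [ENNReal.ofReal_inv_of_pos two_pos]; simp
    simp only [hp, symWeight, tanhHalf_checkOp]
    rw [h5, ← ENNReal.ofReal_mul (p := 1 + tanhHalf y) (by linarith),
      ← ENNReal.ofReal_mul (p := 1 + tanhHalf x) (by linarith),
      ← ENNReal.ofReal_mul (by norm_num), ← ENNReal.ofReal_mul (by norm_num),
      ← ENNReal.ofReal_add (by nlinarith) (by nlinarith)]
    congr 1; ring
  have hgc : Measurable (fun q : EReal × EReal => g (checkOp q.1 q.2)) :=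
    hg.comp measurable_checkOp
  have hgx : ∀ x, Measurable fun y => g (checkOp x y) := fun x =>
    hgc.comp measurable_prodMk_left
  have expand : ∀ f : EReal → EReal → ENNReal, Measurable (Function.uncurry f) →
      ∫⁻ x, ∫⁻ y, f x y * symWeight (checkOp x y) ∂b ∂a =
        ∫⁻ x, (2⁻¹ * ∫⁻ y, f x y * p y ∂b) * symWeight x ∂a +
          ∫⁻ x, 2⁻¹ * p x * ∫⁻ y, f x y * symWeight y ∂b ∂a := by
    intro f hf
    have hfx : ∀ x, Measurable (f x) := fun x => hf.comp measurable_prodMk_left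
    rw [← lintegral_add_left]
    · refine lintegral_congr fun x => ?_
      have m1 : Measurable (fun y => f x y * p y) := (hfx x).mul hpm
      have m2 : Measurable (fun y => f x y * symWeight y) := (hfx x).mul measurable_symWeight
      rw [← lintegral_const_mul _ m1, ← lintegral_mul_const _ (m1.const_mul _),
        ← lintegral_const_mul _ m2, ← lintegral_add_left ((m1.const_mul _).mul_const _)]
      refine lintegral_congr fun y => ?_
      rw [hw]; ring
    · refine Measurable.mul (Measurable.const_mul ?_ _) measurable_symWeight
      exact Measurable.lintegral_prod_right'
        (f := fun q : EReal × EReal => f q.1 q.2 * p q.2) (hf.mul (hpm.comp measurable_snd))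
  rw [expand (fun x y => g (-checkOp x y)) (hg.comp (continuous_neg.measurable.comp measurable_checkOp)),
    expand (fun x y => g (checkOp x y)) hgc]
  congr 1
  · simp_rw [← checkOp_neg_left]
    refine ha.symm (fun x => 2⁻¹ * ∫⁻ y, g (checkOp x y) * p y ∂b) (Measurable.const_mul ?_ _)
    exact Measurable.lintegral_prod_right'
      (f := fun q : EReal × EReal => g (checkOp q.1 q.2) * p q.2)
      (hgc.mul (hpm.comp measurable_snd))
  · simp_rw [← checkOp_neg_right, fun x => hb.symm (fun y => g (checkOp x y)) (hgx x)]

/-! ### Entropy of symmetric measures -/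

/-- The integrand is `symWeight` times 1/(1 + z), and reflecting the second factor turns the product
into (1 - z)/(1 - z). It is only bounded by 1 because at ⊤ it is 0. -/
theorem IsSym.lintegral_exp_neg_le {c : Measure EReal} (h : IsSym c) :
    ∫⁻ x, EReal.exp (-x) ∂c ≤ 1 := by
  have := h.isProb
  set g : EReal → ENNReal := fun x => (ENNReal.ofReal (1 + tanhHalf x))⁻¹ with hg
  have hgm : Measurable g := (measurable_const.add measurable_tanhHalf).ennreal_ofReal.inv
  calc ∫⁻ x, EReal.exp (-x) ∂c = ∫⁻ x, g x * symWeight x ∂c := by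
        refine lintegral_congr_ae ?_
        filter_upwards [h.ae_ne_bot] with x hx
        have := neg_one_lt_tanhHalf hx
        rw [exp_neg_eq_tanhHalf hx, ENNReal.ofReal_div_of_pos (by linarith), div_eq_mul_inv,
          mul_comm, symWeight]
    _ = ∫⁻ x, g (-x) * symWeight x ∂c := (h.symm g hgm).symm
    _ ≤ ∫⁻ _, 1 ∂c := by
        refine lintegral_mono fun x => ?_
        simp only [hg, tanhHalf_neg, ← sub_eq_add_neg]
        exact ENNReal.inv_mul_le_one _
    _ = 1 := by simp

theorem IsSym.integrable_exp_neg {c : Measure EReal} (h : IsSym c) :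
    Integrable (fun x => (EReal.exp (-x)).toReal) c :=
  integrable_toReal_of_lintegral_ne_top measurable_exp_neg.aemeasurable
    (h.lintegral_exp_neg_le.trans_lt ENNReal.one_lt_top).ne

theorem IsSym.integral_exp_neg_le {c : Measure EReal} (h : IsSym c) :
    ∫ x, (EReal.exp (-x)).toReal ∂c ≤ 1 := by
  have hlt : ∀ᵐ x ∂c, EReal.exp (-x) < ⊤ :=
    ae_lt_top measurable_exp_neg (h.lintegral_exp_neg_le.trans_lt ENNReal.one_lt_top).ne
  rw [integral_toReal measurable_exp_neg.aemeasurable hlt]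
  exact ENNReal.toReal_le_of_le_ofReal zero_le_one (by simpa using h.lintegral_exp_neg_le)

/-- The tangent of `u ↦ log (1 + u)` at `u = 1`. -/
theorem log_one_add_lt {u : ℝ} (hu : 0 ≤ u) (h1 : u ≠ 1) :
    Real.log (1 + u) < Real.log 2 + (u - 1) / 2 := by
  have h := Real.log_lt_sub_one_of_pos (x := (1 + u) / 2) (by linarith) (by
    intro h; apply h1; linarith)
  rw [Real.log_div (by linarith) two_ne_zero] at h
  linarith

theorem entropyKernel_le (x : EReal) :
    entropyKernel x ≤ 1 + ((EReal.exp (-x)).toReal - 1) / (2 * Real.log 2) := by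
  have hl := Real.log_pos one_lt_two
  have hu : 0 ≤ (EReal.exp (-x)).toReal := ENNReal.toReal_nonneg
  rw [entropyKernel, Real.logb, div_le_iff₀ hl]
  have h2 : (1 + ((EReal.exp (-x)).toReal - 1) / (2 * Real.log 2)) * Real.log 2 =
      Real.log 2 + ((EReal.exp (-x)).toReal - 1) / 2 := by field_simp
  rw [h2]
  by_cases h1 : (EReal.exp (-x)).toReal = 1
  · rw [h1]; norm_num
  · exact (log_one_add_lt hu h1).le

theorem entropyKernel_lt {x : EReal} (hx : 0 < x) :
    entropyKernel x < 1 + ((EReal.exp (-x)).toReal - 1) / (2 * Real.log 2) := by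
  have hl := Real.log_pos one_lt_two
  have hu : 0 ≤ (EReal.exp (-x)).toReal := ENNReal.toReal_nonneg
  have h1 : (EReal.exp (-x)).toReal ≠ 1 := by
    intro h
    rw [ENNReal.toReal_eq_one_iff] at h
    have : EReal.exp (-x) < 1 := by simpa using hx
    exact this.ne h
  rw [entropyKernel, Real.logb, div_lt_iff₀ hl]
  have h2 : (1 + ((EReal.exp (-x)).toReal - 1) / (2 * Real.log 2)) * Real.log 2 =
      Real.log 2 + ((EReal.exp (-x)).toReal - 1) / 2 := by field_simp
  rw [h2]
  exact log_one_add_lt hu h1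

theorem IsSym.integrable_tangent {c : Measure EReal} (h : IsSym c) :
    Integrable (fun x => 1 + ((EReal.exp (-x)).toReal - 1) / (2 * Real.log 2)) c := by
  have := h.isProb
  exact (integrable_const 1).add ((h.integrable_exp_neg.sub (integrable_const 1)).div_const _)

theorem IsSym.integrable_entropyKernel {c : Measure EReal} (h : IsSym c) :
    Integrable entropyKernel c :=
  h.integrable_tangent.mono' measurable_entropyKernel.aestronglyMeasurable
    (Filter.Eventually.of_forall fun x => by
      rw [Real.norm_of_nonneg (entropyKernel_nonneg x)]; exact entropyKernel_le x)

/-- A measure is informative if it charges the positive log-likelihood ratios. -/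
def Informative (c : Measure EReal) : Prop := c (Set.Ioi 0) ≠ 0

/-- Integrate the tangent bound for log(1 + u) at u = 1, with u = exp(-x). It is strict on the
positive LLRs, which carry mass, and its integral is at most 1 because exp(-x) has mean at most 1.
-/
theorem IsSym.entropy_lt_one {c : Measure EReal} (h : IsSym c) (hi : Informative c) :
    entropy c < 1 := by
  have := h.isProb
  have hl := Real.log_pos one_lt_two
  have h1 : entropy c < ∫ x, (1 + ((EReal.exp (-x)).toReal - 1) / (2 * Real.log 2)) ∂c := by
    have he : entropy c = ∫ x, entropyKernel x ∂c := rfl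
    rw [← sub_pos, he, ← integral_sub h.integrable_tangent h.integrable_entropyKernel,
      integral_pos_iff_support_of_nonneg (fun x => sub_nonneg.2 (entropyKernel_le x))
        (h.integrable_tangent.sub h.integrable_entropyKernel)]
    exact (pos_iff_ne_zero.2 hi).trans_le
      (measure_mono fun x hx => (sub_pos.2 (entropyKernel_lt hx)).ne')
  refine h1.trans_le ?_
  have hint : Integrable (fun x => (EReal.exp (-x)).toReal - 1) c :=
    h.integrable_exp_neg.sub (integrable_const 1)
  rw [integral_add (integrable_const 1) (hint.div_const _), integral_div,
    integral_sub h.integrable_exp_neg (integrable_const 1)]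
  have h2 := h.integral_exp_neg_le
  simp only [integral_const, probReal_univ, smul_eq_mul, mul_one]
  have : (∫ x, (EReal.exp (-x)).toReal ∂c - 1) / (2 * Real.log 2) ≤ 0 :=
    div_nonpos_of_nonpos_of_nonneg (by linarith) (by positivity)
  linarith

/-- Testing symmetry with the indicator of the positive half-line transfers the absence of mass
there to the negative half-line, where the weight is positive. Only the point 0 remains. -/
theorem IsSym.eq_delta0_of_not_informative {c : Measure EReal} (h : IsSym c)
    (hi : ¬ Informative c) : c = delta0 := by
  have := h.isProb
  have hpos : c (Set.Ioi 0) = 0 := not_not.1 hi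
  have hs := h.symm (Set.indicator (Set.Ioi 0) 1) (measurable_one.indicator measurableSet_Ioi)
  have h0 : ∫⁻ x, Set.indicator (Set.Ioi 0) (1 : EReal → ENNReal) x * symWeight x ∂c = 0 := by
    rw [← lintegral_zero (μ := c)]
    refine lintegral_congr_ae ?_
    filter_upwards [compl_mem_ae_iff.2 hpos] with x hx
    simp [Set.indicator_of_notMem hx]
  have hm : Measurable fun x : EReal =>
      Set.indicator (Set.Ioi 0) (1 : EReal → ENNReal) (-x) * symWeight x :=
    ((measurable_one.indicator measurableSet_Ioi).comp continuous_neg.measurable).mul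
      measurable_symWeight
  rw [h0, lintegral_eq_zero_iff hm] at hs
  have hae : ∀ᵐ x ∂c, x ∈ ({0} : Set EReal) := by
    filter_upwards [hs, compl_mem_ae_iff.2 hpos] with x hx hx'
    rw [Set.mem_singleton_iff]
    refine le_antisymm (not_lt.1 hx') (not_lt.1 fun hneg => ?_)
    have hmem : -x ∈ Set.Ioi (0 : EReal) := by simpa using hneg
    have hz : tanhHalf x < 1 := tanhHalf_lt_one (by rintro rfl; simp at hneg)
    rw [Set.indicator_of_mem hmem] at hx
    simp [symWeight] at hx
    linarith
  have hc : c.restrict {0} = c := Measure.restrict_eq_self_of_ae_mem hae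
  have h1 : c {0} = 1 := (mem_ae_iff_prob_eq_one (measurableSet_singleton 0)).1 hae
  rw [← hc, Measure.restrict_singleton, h1, one_smul, delta0]

/-! ### Informative measures under convolution; neutral and absorbing elements -/

theorem informative_of_mem {op : EReal → EReal → EReal} {a b : Measure EReal}
    (hop : Measurable (fun p : EReal × EReal => op p.1 p.2))
    (hpos : ∀ x y, 0 < x → 0 < y → 0 < op x y)
    [SFinite b] (ha : Informative a) (hb : Informative b) : Informative (opConv op a b) := by
  intro h
  rw [opConv, Measure.map_apply hop measurableSet_Ioi] at h
  have h2 : (a.prod b) (Set.Ioi 0 ×ˢ Set.Ioi 0) = 0 :=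
    measure_mono_null (fun p hp => hpos _ _ hp.1 hp.2) h
  rw [Measure.prod_prod, mul_eq_zero] at h2
  exact h2.elim ha hb

theorem IsSym.informative_checkConv {a b : Measure EReal} (hb' : IsSym b)
    (ha : Informative a) (hb : Informative b) : Informative (PolarGap.checkConv a b) := by
  have := hb'.isProb
  exact informative_of_mem measurable_checkOp (fun _ _ => checkOp_pos) ha hb

theorem informative_deltaInf : Informative deltaInf := by
  simp [Informative, deltaInf]

theorem varConv_delta0 (a : Measure EReal) [SFinite a] : varConv a delta0 = a :=
  Measure.conv_dirac_zero a

theorem delta0_varConv (a : Measure EReal) [SFinite a] : varConv delta0 a = a :=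
  Measure.dirac_zero_conv a

/-- A symmetric `b` is either informative, and then the open positive quadrant has positive mass, or
it is the neutral element Δ_0. -/
theorem IsSym.informative_varConv_left {a b : Measure EReal} (ha' : IsSym a) (hb' : IsSym b)
    (ha : Informative a) : Informative (PolarGap.varConv a b) := by
  have := ha'.isProb
  have := hb'.isProb
  by_cases hb : Informative b
  · exact informative_of_mem measurable_addOp (fun _ _ h1 h2 => EReal.add_pos h1 h2) ha hb
  · rw [hb'.eq_delta0_of_not_informative hb, varConv_delta0]; exact ha

theorem varConv_comm (a b : Measure EReal) [SFinite a] [SFinite b] : varConv a b = varConv b a :=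
  Measure.conv_comm a b

theorem IsSym.informative_varConv_right {a b : Measure EReal} (ha' : IsSym a) (hb' : IsSym b)
    (hb : Informative b) : Informative (PolarGap.varConv a b) := by
  have := ha'.isProb
  have := hb'.isProb
  rw [varConv_comm]
  exact hb'.informative_varConv_left ha' hb

theorem delta0_checkConv (a : Measure EReal) [IsProbabilityMeasure a] :
    checkConv delta0 a = delta0 := by
  refine Measure.ext_of_lintegral _ fun f hf => ?_
  rw [checkConv_eq_opConv, lintegral_opConv measurable_checkOp _ _ hf]
  simp [delta0, checkOp_zero_left]

theorem entropy_delta0 : entropy delta0 = 1 := by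
  simp only [entropy, delta0, integral_dirac, neg_zero, EReal.exp_zero, ENNReal.toReal_one]
  norm_num

theorem entropy_deltaInf : entropy deltaInf = 0 := by
  simp [entropy, deltaInf]

/-- Symmetry is needed because ⊤ + ⊥ = ⊥ in `EReal`. -/
theorem IsSym.varConv_deltaInf {a : Measure EReal} (h : IsSym a) :
    PolarGap.varConv deltaInf a = deltaInf := by
  have := h.isProb
  refine Measure.ext_of_lintegral _ fun f hf => ?_
  rw [varConv_eq_opConv, lintegral_opConv measurable_addOp _ _ hf, deltaInf, lintegral_dirac,
    lintegral_dirac]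
  have : ∀ᵐ y ∂a, f (⊤ + y) = f ⊤ := by
    filter_upwards [h.ae_ne_bot] with y hy
    rw [EReal.top_add_of_ne_bot hy]
  rw [lintegral_congr_ae this]
  simp

/-- Duality between the entropies of the two convolutions. -/
theorem IsSym.entropy_varConv_add_checkConv {a b : Measure EReal} (ha : IsSym a) (hb : IsSym b) :
    entropy (PolarGap.varConv a b) + entropy (PolarGap.checkConv a b) = entropy a + entropy b := by
  have := ha.isProb
  have := hb.isProb
  have e1 : entropy (PolarGap.varConv a b) =
      ∫ p, entropyKernel (p.1 + p.2) ∂(a.prod b) :=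
    integral_map measurable_addOp.aemeasurable measurable_entropyKernel.aestronglyMeasurable
  have e2 : entropy (PolarGap.checkConv a b) =
      ∫ p, entropyKernel (checkOp p.1 p.2) ∂(a.prod b) :=
    integral_map measurable_checkOp.aemeasurable measurable_entropyKernel.aestronglyMeasurable
  have e3 : entropy a = ∫ p, entropyKernel p.1 ∂(a.prod b) := by
    rw [integral_fun_fst]; simp [entropy, entropyKernel]
  have e4 : entropy b = ∫ p, entropyKernel p.2 ∂(a.prod b) := by
    rw [integral_fun_snd]; simp [entropy, entropyKernel]
  have i1 : Integrable (fun p : EReal × EReal => entropyKernel (p.1 + p.2)) (a.prod b) :=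
    (ha.varConv hb).integrable_entropyKernel.comp_measurable measurable_addOp
  have i2 : Integrable (fun p : EReal × EReal => entropyKernel (checkOp p.1 p.2)) (a.prod b) :=
    (ha.checkConv hb).integrable_entropyKernel.comp_measurable measurable_checkOp
  have i3 : Integrable (fun p : EReal × EReal => entropyKernel p.1) (a.prod b) :=
    ha.integrable_entropyKernel.comp_fst b
  have i4 : Integrable (fun p : EReal × EReal => entropyKernel p.2) (a.prod b) :=
    hb.integrable_entropyKernel.comp_snd a
  rw [e1, e2, e3, e4, ← integral_add i1 i2, ← integral_add i3 i4]
  refine integral_congr_ae ?_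
  have hx : ∀ᵐ p ∂(a.prod b), p.1 ≠ ⊥ := Measure.quasiMeasurePreserving_fst.ae ha.ae_ne_bot
  have hy : ∀ᵐ p ∂(a.prod b), p.2 ≠ ⊥ := Measure.quasiMeasurePreserving_snd.ae hb.ae_ne_bot
  filter_upwards [hx, hy] with p hp1 hp2
  exact entropyKernel_add_checkOp hp1 hp2

/-! ### Iterated convolutions -/

theorem varConv_left_comm {a b c : Measure EReal} (ha : IsSym a) (hb : IsSym b) (hc : IsSym c) :
    varConv a (varConv b c) = varConv b (varConv a c) := by
  have := ha.isProb
  have := hb.isProb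
  have := hc.isProb
  exact opConv_left_comm measurable_addOp add_left_comm a b c

theorem checkConv_left_comm {a b c : Measure EReal} (ha : IsSym a) (hb : IsSym b)
    (hc : IsSym c) : checkConv a (checkConv b c) = checkConv b (checkConv a c) := by
  have := ha.isProb
  have := hb.isProb
  have := hc.isProb
  exact opConv_left_comm measurable_checkOp checkOp_left_comm a b c

section foldr

variable {ι : Type} {op : Measure EReal → Measure EReal → Measure EReal} {e : Measure EReal}

theorem isSym_foldr (hop : ∀ a b, IsSym a → IsSym b → IsSym (op a b)) (he : IsSym e)
    {m : ι → Measure EReal} (hm : ∀ j, IsSym (m j)) (l : List ι) :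
    IsSym (l.foldr (fun j acc => op (m j) acc) e) := by
  induction l with
  | nil => exact he
  | cons j l ih => exact hop _ _ (hm j) ih

/-- The order of `Finset.toList` is unspecified; with this lemma any chosen factor can be moved to
the front. -/
theorem foldr_perm (hop : ∀ a b, IsSym a → IsSym b → IsSym (op a b)) (he : IsSym e)
    (hlc : ∀ a b c, IsSym a → IsSym b → IsSym c → op a (op b c) = op b (op a c))
    {m : ι → Measure EReal} (hm : ∀ j, IsSym (m j)) {l l' : List ι} (h : l.Perm l') :
    l.foldr (fun j acc => op (m j) acc) e = l'.foldr (fun j acc => op (m j) acc) e := by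
  induction h with
  | nil => rfl
  | cons j _ ih => simp only [List.foldr_cons, ih]
  | swap j k l =>
    exact hlc _ _ _ (hm k) (hm j) (isSym_foldr hop he hm l)
  | trans _ _ ih1 ih2 => exact ih1.trans ih2

theorem foldr_congr_mem {m m' : ι → Measure EReal} {l : List ι} (h : ∀ j ∈ l, m j = m' j) :
    l.foldr (fun j acc => op (m j) acc) e = l.foldr (fun j acc => op (m' j) acc) e := by
  induction l with
  | nil => rfl
  | cons j l ih =>
    simp only [List.foldr_cons]
    rw [h j (by simp), ih fun k hk => h k (by simp [hk])]

end foldr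

section big

variable {ι : Type} {m m' : ι → Measure EReal} {S : Finset ι}

theorem isSym_bigVarConv (hm : ∀ j, IsSym (m j)) : IsSym (bigVarConv S m) :=
  isSym_foldr (fun _ _ => IsSym.varConv) isSym_delta0 hm _

theorem isSym_bigCheckConv (hm : ∀ j, IsSym (m j)) : IsSym (bigCheckConv S m) :=
  isSym_foldr (fun _ _ => IsSym.checkConv) isSym_deltaInf hm _

theorem bigVarConv_congr (h : ∀ j ∈ S, m j = m' j) : bigVarConv S m = bigVarConv S m' :=
  foldr_congr_mem fun j hj => h j (by simpa using hj)

theorem bigCheckConv_congr (h : ∀ j ∈ S, m j = m' j) : bigCheckConv S m = bigCheckConv S m' :=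
  foldr_congr_mem fun j hj => h j (by simpa using hj)

theorem bigVarConv_erase [DecidableEq ι] (hm : ∀ j, IsSym (m j)) {j : ι} (hj : j ∈ S) :
    bigVarConv S m = varConv (m j) (bigVarConv (S.erase j) m) := by
  have h := Finset.toList_insert (Finset.notMem_erase j S)
  rw [Finset.insert_erase hj] at h
  exact foldr_perm (fun _ _ => IsSym.varConv) isSym_delta0
    (fun _ _ _ => varConv_left_comm) hm h

theorem bigCheckConv_erase [DecidableEq ι] (hm : ∀ j, IsSym (m j)) {j : ι} (hj : j ∈ S) :
    bigCheckConv S m = checkConv (m j) (bigCheckConv (S.erase j) m) := by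
  have h := Finset.toList_insert (Finset.notMem_erase j S)
  rw [Finset.insert_erase hj] at h
  exact foldr_perm (fun _ _ => IsSym.checkConv) isSym_deltaInf
    (fun _ _ _ => checkConv_left_comm) hm h

theorem bigVarConv_eq_delta0 (h : ∀ j ∈ S, m j = delta0) : bigVarConv S m = delta0 := by
  have h' : ∀ l : List ι, l.foldr (fun _ acc => varConv delta0 acc) delta0 = delta0 := by
    intro l
    induction l with
    | nil => rfl
    | cons j l ih =>
      have := isSym_delta0.isProb
      rw [List.foldr_cons, ih, varConv_delta0]
  rw [bigVarConv_congr (m' := fun _ => delta0) h]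
  exact h' _

/-- Δ_0 is absorbing: a check that has not heard from one neighbour can tell the others nothing. -/
theorem bigCheckConv_eq_delta0 (hm : ∀ j, IsSym (m j)) {j : ι} (hj : j ∈ S)
    (h : m j = delta0) : bigCheckConv S m = delta0 := by
  classical
  have hs : IsSym (bigCheckConv (S.erase j) m) := isSym_bigCheckConv hm
  have := hs.isProb
  rw [bigCheckConv_erase hm hj, h, delta0_checkConv]

theorem informative_bigVarConv (hm : ∀ j, IsSym (m j)) {j : ι} (hj : j ∈ S)
    (h : Informative (m j)) : Informative (bigVarConv S m) := by
  classical
  rw [bigVarConv_erase hm hj]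
  exact (hm j).informative_varConv_left (isSym_bigVarConv hm) h

theorem informative_bigCheckConv (hm : ∀ j, IsSym (m j)) (h : ∀ j ∈ S, Informative (m j)) :
    Informative (bigCheckConv S m) := by
  have h' : ∀ l : List ι, (∀ j ∈ l, Informative (m j)) →
      Informative (l.foldr (fun j acc => checkConv (m j) acc) deltaInf) := by
    intro l hl
    induction l with
    | nil => exact informative_deltaInf
    | cons j l ih =>
      exact IsSym.informative_checkConv
        (isSym_foldr (fun _ _ => IsSym.checkConv) isSym_deltaInf hm l) (hl j (by simp))
        (ih fun k hk => hl k (by simp [hk]))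
  exact h' _ fun j hj => h j (by simpa using hj)

end big

/-! ### The effect of an update on the potential -/

/-- All messages are symmetric. -/
structure Messages.AllSym {V C : Type} (m : Messages V C) : Prop where
  v2c : ∀ i α, IsSym (m.v2c i α)
  c2v : ∀ α i, IsSym (m.c2v α i)

namespace FactorGraph

variable {V C : Type} [Fintype V] [Fintype C] [DecidableEq V] [DecidableEq C]

/-- The message from `i` to `α` before any hard decision. -/
def softV2C (G : FactorGraph V C) (m : Messages V C) (i : V) (α : C) : Measure EReal :=
  varConv (G.chan i) (bigVarConv ((G.varNbr i).erase α) (fun h => m.c2v h i))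

theorem newV2C_of_notMem {G : FactorGraph V C} {i : V} (hi : i ∉ G.hardSource)
    (m : Messages V C) (α : C) : G.newV2C m i α = G.softV2C m i α := by
  rw [newV2C, if_neg hi, softV2C]

variable (G : FactorGraph V C) (m m' : Messages V C)

theorem update_v2c_v2c (i j : V) (α β : C) : (G.update m (.v2c i α)).v2c j β =
    if j = i ∧ β = α then G.newV2C m i α else m.v2c j β := by
  by_cases hj : j = i
  · subst hj
    by_cases hb : β = α
    · subst hb; simp [update]
    · simp [update, hb]
  · simp [update, hj]

theorem update_c2v_c2v (i j : V) (α β : C) : (G.update m (.c2v α i)).c2v β j =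
    if β = α ∧ j = i then G.newC2V m α i else m.c2v β j := by
  by_cases hb : β = α
  · subst hb
    by_cases hj : j = i
    · subst hj; simp [update]
    · simp [update, hj]
  · simp [update, hb]

theorem update_v2c_c2v (i j : V) (α β : C) :
    (G.update m (.v2c i α)).c2v β j = m.c2v β j := rfl

theorem update_c2v_v2c (i j : V) (α β : C) :
    (G.update m (.c2v α i)).v2c j β = m.v2c j β := rfl

variable {G m m'}

theorem isSym_softV2C (hG : ∀ i, IsSym (G.chan i)) (hm : m.AllSym) (i : V) (α : C) :
    IsSym (G.softV2C m i α) :=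
  (hG i).varConv (isSym_bigVarConv fun h => hm.c2v h i)

theorem isSym_newV2C (hG : ∀ i, IsSym (G.chan i)) (hm : m.AllSym) (i : V) (α : C) :
    IsSym (G.newV2C m i α) := by
  unfold newV2C
  split_ifs
  · exact isSym_deltaInf
  · exact isSym_softV2C hG hm i α

theorem isSym_newC2V (hm : m.AllSym) (α : C) (i : V) : IsSym (G.newC2V m α i) :=
  isSym_bigCheckConv fun j => hm.v2c j α

theorem allSym_update (hG : ∀ i, IsSym (G.chan i)) (hm : m.AllSym) (e : DirEdge V C) :
    (G.update m e).AllSym := by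
  cases e with
  | v2c i α =>
    refine ⟨fun j β => ?_, fun β j => hm.c2v β j⟩
    rw [update_v2c_v2c]
    split_ifs
    · exact isSym_newV2C hG hm i α
    · exact hm.v2c j β
  | c2v α i =>
    refine ⟨fun j β => hm.v2c j β, fun β j => ?_⟩
    rw [update_c2v_c2v]
    split_ifs
    · exact isSym_newC2V hm α i
    · exact hm.c2v β j

theorem softV2C_congr {i : V} {α : C} (h : ∀ β, i ∈ G.nbr β → β ≠ α → m.c2v β i = m'.c2v β i) :
    G.softV2C m i α = G.softV2C m' i α := by
  unfold softV2C
  rw [bigVarConv_congr fun β hβ => ?_]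
  rw [Finset.mem_erase, varNbr, Finset.mem_filter] at hβ
  exact h β hβ.2.2 hβ.1

theorem newC2V_congr {i : V} {α : C} (h : ∀ j ∈ G.nbr α, j ≠ i → m.v2c j α = m'.v2c j α) :
    G.newC2V m α i = G.newC2V m' α i := by
  unfold newC2V
  refine bigCheckConv_congr fun j hj => ?_
  rw [Finset.mem_erase] at hj
  exact h j hj.2 hj.1

theorem varConv_chan_eq (hG : ∀ i, IsSym (G.chan i)) (hm : m.AllSym) {i : V} {α : C}
    (hi : i ∈ G.nbr α) : varConv (G.chan i) (bigVarConv (G.varNbr i) fun α => m.c2v α i) =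
      varConv (m.c2v α i) (G.softV2C m i α) := by
  rw [bigVarConv_erase (j := α) (fun h => hm.c2v h i) (by simp [varNbr, hi]),
    varConv_left_comm (hG i) (hm.c2v α i) (isSym_bigVarConv fun h => hm.c2v h i), softV2C]

theorem bigCheckConv_nbr_eq (hm : m.AllSym) {i : V} {α : C} (hi : i ∈ G.nbr α) :
    bigCheckConv (G.nbr α) (fun i => m.v2c i α) = checkConv (m.v2c i α) (G.newC2V m α i) :=
  bigCheckConv_erase (fun j => hm.v2c j α) hi

theorem sum_sub_sum_eq_single {ι : Type*} (S : Finset ι) (f g : ι → ℝ) {i : ι} (hi : i ∈ S)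
    (h : ∀ j ∈ S, j ≠ i → f j = g j) : ∑ j ∈ S, f j - ∑ j ∈ S, g j = f i - g i := by
  rw [← Finset.sum_sub_distrib]
  exact Finset.sum_eq_single_of_mem i hi fun j hj hji => by rw [h j hj hji, sub_self]

theorem sum_nbr_sub_sum_nbr (f g : V → C → ℝ) {i : V} {α : C} (hi : i ∈ G.nbr α)
    (h : ∀ j β, ¬(j = i ∧ β = α) → f j β = g j β) :
    ∑ β, ∑ j ∈ G.nbr β, f j β - ∑ β, ∑ j ∈ G.nbr β, g j β = f i α - g i α := by
  rw [sum_sub_sum_eq_single _ _ _ (Finset.mem_univ α)]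
  · exact sum_sub_sum_eq_single _ _ _ hi fun j _ hj => h j α fun hh => hj hh.1
  · exact fun β _ hβ => Finset.sum_congr rfl fun j _ => h j β fun hh => hβ hh.2

/-- The message occurs in the entropy at `i` and in the edge entropy. Both have the form H(message ⊛
b), with `softV2C` as b in the former and the stored `v2c` in the latter, and they enter with
opposite signs. -/
theorem potential_update_c2v (hG : ∀ i, IsSym (G.chan i)) (hm : m.AllSym) {i : V} {α : C}
    (hi : i ∈ G.nbr α) (N : ℕ) :
    G.potential N (G.update m (.c2v α i)) = G.potential N m - 1 / (N : ℝ) *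
      ((entropy (varConv (G.newC2V m α i) (G.softV2C m i α)) -
          entropy (varConv (m.c2v α i) (G.softV2C m i α))) -
        (entropy (varConv (m.v2c i α) (G.newC2V m α i)) -
          entropy (varConv (m.v2c i α) (m.c2v α i)))) := by
  set m1 := G.update m (.c2v α i) with hm1
  have hm1s : m1.AllSym := allSym_update hG hm _
  have h1 := sum_sub_sum_eq_single Finset.univ
    (fun j => entropy (varConv (G.chan j) (bigVarConv (G.varNbr j) fun α => m1.c2v α j)))
    (fun j => entropy (varConv (G.chan j) (bigVarConv (G.varNbr j) fun α => m.c2v α j)))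
    (Finset.mem_univ i) fun j _ hj => by
      rw [bigVarConv_congr fun β _ => ?_]
      rw [hm1, update_c2v_c2v, if_neg fun h => hj h.2]
  have h2 := sum_nbr_sub_sum_nbr (G := G)
    (fun j β => entropy (varConv (m1.v2c j β) (m1.c2v β j)))
    (fun j β => entropy (varConv (m.v2c j β) (m.c2v β j))) hi fun j β h => by
      rw [hm1, update_c2v_c2v, if_neg fun hh => h hh.symm, update_c2v_v2c]
  have hs : G.softV2C m1 i α = G.softV2C m i α := softV2C_congr fun β _ hβ => by
    rw [hm1, update_c2v_c2v, if_neg fun h => hβ h.1]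
  have ha : m1.c2v α i = G.newC2V m α i := by
    rw [hm1, update_c2v_c2v, if_pos ⟨rfl, rfl⟩]
  have hv : m1.v2c = m.v2c := rfl
  simp only [varConv_chan_eq hG hm1s hi, varConv_chan_eq hG hm hi, hs, ha] at h1
  simp only [ha, hv] at h2
  simp only [potential, hv]
  linear_combination (-(1 / (N : ℝ))) * h1 + (1 / (N : ℝ)) * h2

theorem potential_update_c2v_eq (hG : ∀ i, IsSym (G.chan i)) (hm : m.AllSym) {i : V} {α : C}
    (hi : i ∈ G.nbr α) (N : ℕ) (h : m.v2c i α = G.softV2C m i α) :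
    G.potential N (G.update m (.c2v α i)) = G.potential N m := by
  have := (hm.v2c i α).isProb
  have := (hm.c2v α i).isProb
  have := (isSym_newC2V (G := G) hm α i).isProb
  rw [potential_update_c2v hG hm hi, ← h, varConv_comm (m.v2c i α), varConv_comm (m.v2c i α)]
  ring

/-- The prior Δ_∞ keeps the entropy at `i` equal to 0 throughout, while the edge entropy falls from
H(Δ_0) = 1 to the entropy of the new message. -/
theorem potential_update_c2v_lt (hG : ∀ i, IsSym (G.chan i)) (hm : m.AllSym) {i : V} {α : C}
    (hi : i ∈ G.nbr α) {N : ℕ} (hN : 0 < N) (hc : G.chan i = deltaInf)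
    (hv : m.v2c i α = delta0) (ha : m.c2v α i = delta0) (hn : Informative (G.newC2V m α i)) :
    G.potential N (G.update m (.c2v α i)) < G.potential N m := by
  have hns : IsSym (G.newC2V m α i) := isSym_newC2V hm α i
  have := hns.isProb
  have := isSym_delta0.isProb
  have := isSym_deltaInf.isProb
  have hs : G.softV2C m i α = deltaInf := by
    rw [softV2C, hc]
    exact (isSym_bigVarConv fun h => hm.c2v h i).varConv_deltaInf
  rw [potential_update_c2v hG hm hi, hs, ha, hv, varConv_comm _ deltaInf, hns.varConv_deltaInf,
    delta0_varConv, delta0_varConv, delta0_varConv, entropy_deltaInf, entropy_delta0]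
  have h1 := hns.entropy_lt_one hn
  have hN' : 0 < 1 / (N : ℝ) := by positivity
  have := mul_pos hN' (sub_pos.2 h1)
  linarith

/-- Write a for the updated message and b for the opposite one. As b is current, the terms
containing a are H(a) - H(a ⊡ b) - H(a ⊛ b), which duality reduces to -H(b). The value of a plays no
role. -/
theorem potential_update_v2c_eq (hG : ∀ i, IsSym (G.chan i)) (hm : m.AllSym) {i : V} {α : C}
    (hi : i ∈ G.nbr α) (N : ℕ) (h : m.c2v α i = G.newC2V m α i) :
    G.potential N (G.update m (.v2c i α)) = G.potential N m := by
  set m1 := G.update m (.v2c i α) with hm1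
  have hm1s : m1.AllSym := allSym_update hG hm _
  have hv : ∀ j β, ¬(j = i ∧ β = α) → m1.v2c j β = m.v2c j β := fun j β hn => by
    rw [hm1, update_v2c_v2c, if_neg hn]
  have hc : m1.c2v = m.c2v := rfl
  have h2 := sum_nbr_sub_sum_nbr (G := G) (fun j β => entropy (m1.v2c j β))
    (fun j β => entropy (m.v2c j β)) hi fun j β hn => by rw [hv j β hn]
  have h4 := sum_nbr_sub_sum_nbr (G := G)
    (fun j β => entropy (varConv (m1.v2c j β) (m1.c2v β j)))
    (fun j β => entropy (varConv (m.v2c j β) (m.c2v β j))) hi fun j β hn => by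
      rw [hv j β hn, hc]
  have h3 := sum_sub_sum_eq_single Finset.univ
    (fun β => entropy (bigCheckConv (G.nbr β) fun j => m1.v2c j β))
    (fun β => entropy (bigCheckConv (G.nbr β) fun j => m.v2c j β))
    (Finset.mem_univ α) fun β _ hβ => by
      rw [bigCheckConv_congr fun j _ => ?_]
      exact hv j β fun hh => hβ hh.2
  have hq : G.newC2V m1 α i = m.c2v α i := by
    rw [h]
    exact newC2V_congr fun j _ hj => hv j α fun hh => hj hh.1
  simp only [bigCheckConv_nbr_eq hm1s hi, bigCheckConv_nbr_eq hm hi, hq, ← h] at h3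
  -- Duality on the edge, after the update and before it.
  have d1 := (hm1s.v2c i α).entropy_varConv_add_checkConv (hm.c2v α i)
  have d2 := (hm.v2c i α).entropy_varConv_add_checkConv (hm.c2v α i)
  simp only [hc] at h4
  simp only [potential, hc]
  linear_combination (-(1 / (N : ℝ))) * (h2 - h3 - h4 - d1 + d2)

end FactorGraph

/-! ### Agreement of messages and runs of a schedule -/

/-- The check node of a directed edge. -/
def DirEdge.checkNode {V C : Type} : DirEdge V C → C
  | .v2c _ α => α
  | .c2v α _ => α

/-- Two families of messages agree at all check nodes in `D`. -/
def AgreeOn {V C : Type} (D : Set C) (m m' : Messages V C) : Prop :=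
  ∀ γ ∈ D, ∀ j, m.v2c j γ = m'.v2c j γ ∧ m.c2v γ j = m'.c2v γ j

theorem AgreeOn.mono {V C : Type} {D D' : Set C} {m m' : Messages V C} (h : AgreeOn D m m')
    (hD : D' ⊆ D) : AgreeOn D' m m' := fun γ hγ => h γ (hD hγ)

namespace FactorGraph

variable {V C : Type} [Fintype V] [Fintype C] [DecidableEq V] [DecidableEq C]
  {G : FactorGraph V C} {m m' : Messages V C}

/-- The frame rule: an update writes only at its own check node, so non-interference can be tracked
by sets of check nodes. -/
theorem agreeOn_update {D : Set C} {e : DirEdge V C} (he : e.checkNode ∉ D) :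
    AgreeOn D m (G.update m e) := by
  intro γ hγ j
  cases e with
  | v2c i α =>
    have : γ ≠ α := by rintro rfl; exact he hγ
    refine ⟨?_, rfl⟩
    rw [update_v2c_v2c, if_neg fun h => this h.2]
  | c2v α i =>
    have : γ ≠ α := by rintro rfl; exact he hγ
    refine ⟨rfl, ?_⟩
    rw [update_c2v_c2v, if_neg fun h => this h.1]

theorem softV2C_update_v2c (i j : V) (α β : C) :
    G.softV2C (G.update m (.v2c i α)) j β = G.softV2C m j β := rfl

theorem softV2C_update_c2v {i j : V} {α β : C} (h : j = i → β = α) :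
    G.softV2C (G.update m (.c2v α i)) j β = G.softV2C m j β :=
  softV2C_congr fun γ _ hγ => by
    rw [update_c2v_c2v, if_neg]
    rintro ⟨rfl, hj⟩
    exact hγ (h hj).symm

theorem newC2V_update_c2v (i j : V) (α β : C) :
    G.newC2V (G.update m (.c2v α i)) β j = G.newC2V m β j := rfl

theorem newC2V_update_v2c {i j : V} {α β : C} (h : β = α → j = i) :
    G.newC2V (G.update m (.v2c i α)) β j = G.newC2V m β j :=
  newC2V_congr fun k _ hk => by
    rw [update_v2c_v2c, if_neg]
    rintro ⟨rfl, hb⟩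
    exact hk (h hb).symm

/-- The node `i` receives information from its channel or from a check node other than `α` and
`β`. -/
def Sourced (G : FactorGraph V C) (m : Messages V C) (i : V) (α β : C) : Prop :=
  Informative (G.chan i) ∨ ∃ ρ, i ∈ G.nbr ρ ∧ ρ ≠ α ∧ ρ ≠ β ∧ Informative (m.c2v ρ i)

/-- The source lies outside both checks of the butterfly, so it is counted in the message to either
of them. -/
theorem Sourced.informative_softV2C {i : V} {α β γ : C} (h : G.Sourced m i α β)
    (hG : ∀ i, IsSym (G.chan i)) (hm : m.AllSym) (hγ : γ = α ∨ γ = β) :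
    Informative (G.softV2C m i γ) := by
  have hs : IsSym (bigVarConv ((G.varNbr i).erase γ) fun h => m.c2v h i) :=
    isSym_bigVarConv fun h => hm.c2v h i
  rcases h with h | ⟨ρ, hi, h1, h2, h3⟩
  · exact (hG i).informative_varConv_left hs h
  · refine (hG i).informative_varConv_right hs
      (informative_bigVarConv (j := ρ) (fun h => hm.c2v h i) ?_ h3)
    rw [Finset.mem_erase, varNbr, Finset.mem_filter]
    refine ⟨?_, Finset.mem_univ _, hi⟩
    rintro rfl
    exact hγ.elim h1 h2

theorem Sourced.congr {i : V} {α β : C} (h : G.Sourced m i α β)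
    (hc : ∀ ρ, i ∈ G.nbr ρ → ρ ≠ α → ρ ≠ β → m.c2v ρ i = m'.c2v ρ i) : G.Sourced m' i α β := by
  rcases h with h | ⟨ρ, hi, h1, h2, h3⟩
  · exact Or.inl h
  · exact Or.inr ⟨ρ, hi, h1, h2, by rwa [← hc ρ hi h1 h2]⟩

theorem Sourced.update {i : V} {α β : C} (h : G.Sourced m i α β) {e : DirEdge V C}
    (he : e.checkNode = α ∨ e.checkNode = β) : G.Sourced (G.update m e) i α β := by
  refine h.congr fun ρ _ h1 h2 => ?_
  have hn : e.checkNode ∉ ({ρ} : Set C) := by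
    rintro (hh : e.checkNode = ρ)
    rw [hh] at he
    exact he.elim h1 h2
  exact (agreeOn_update hn ρ rfl i).2

/-- All check nodes adjacent to `i` other than `α` send no information to `i`. -/
def Silent (G : FactorGraph V C) (m : Messages V C) (i : V) (α : C) : Prop :=
  ∀ γ, i ∈ G.nbr γ → γ ≠ α → m.c2v γ i = delta0

theorem Silent.update {i : V} {α : C} (h : G.Silent m i α) {e : DirEdge V C}
    (he : e.varNode ≠ i ∨ e.checkNode = α) : G.Silent (G.update m e) i α := by
  intro γ hγ hne
  rw [← h γ hγ hne]
  cases e with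
  | v2c j β => rfl
  | c2v β j =>
    rw [update_c2v_c2v, if_neg]
    rintro ⟨rfl, rfl⟩
    exact he.elim (fun h => h rfl) hne

/-- The update along `e` lowers the potential strictly if it is counted and incident to a node in
`F`, and preserves the potential otherwise. -/
def StepOK (G : FactorGraph V C) (N : ℕ) (F : V → Prop) (m : Messages V C) (e : DirEdge V C)
    (hard : Bool) : Prop :=
  (hard = false ∧ F e.varNode → G.potential N (G.update m e) < G.potential N m) ∧
    (¬(hard = false ∧ F e.varNode) → G.potential N (G.update m e) = G.potential N m)

variable {N : ℕ} {F : V → Prop}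

theorem stepOK_of_eq {e : DirEdge V C} {hard : Bool} (hF : hard = true ∨ ¬F e.varNode)
    (h : G.potential N (G.update m e) = G.potential N m) : G.StepOK N F m e hard := by
  refine ⟨fun hh => ?_, fun _ => h⟩
  rcases hF with hF | hF
  · exact absurd (hh.1.symm.trans hF) (by simp)
  · exact absurd hh.2 hF

theorem stepOK_v2c (hG : ∀ i, IsSym (G.chan i)) (hm : m.AllSym) {i : V} {α : C} {hard : Bool}
    (hF : hard = true ∨ ¬F i) (hi : i ∈ G.nbr α) (h : m.c2v α i = G.newC2V m α i) :
    G.StepOK N F m (.v2c i α) hard :=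
  stepOK_of_eq hF (potential_update_v2c_eq hG hm hi N h)

theorem stepOK_c2v (hG : ∀ i, IsSym (G.chan i)) (hm : m.AllSym) {i : V} {α : C} {hard : Bool}
    (hF : hard = true ∨ ¬F i) (hi : i ∈ G.nbr α) (h : m.v2c i α = G.softV2C m i α) :
    G.StepOK N F m (.c2v α i) hard :=
  stepOK_of_eq hF (potential_update_c2v_eq hG hm hi N h)

/-- The only kind of step that can lower the potential. Without a frozen prior, a node that has
heard from no other check would send Δ_0, which is the stored message; with the prior Δ_∞ the two
differ. -/
theorem stepOK_c2v_silent (hG : ∀ i, IsSym (G.chan i)) (hm : m.AllSym) {i : V} {α : C}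
    (hN : 0 < N) (hF : (F i ∧ G.chan i = deltaInf) ∨ (¬F i ∧ G.chan i = delta0))
    (hi : i ∈ G.nbr α) (hv : m.v2c i α = delta0) (hc : m.c2v α i = delta0)
    (hs : G.Silent m i α) (hn : Informative (G.newC2V m α i)) :
    G.StepOK N F m (.c2v α i) false := by
  rcases hF with ⟨hF, hch⟩ | ⟨hF, hch⟩
  · exact ⟨fun _ => potential_update_c2v_lt hG hm hi hN hch hv hc hn, fun h => absurd ⟨rfl, hF⟩ h⟩
  · refine stepOK_c2v hG hm (Or.inr hF) hi ?_
    have := isSym_delta0.isProb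
    rw [hv, softV2C, hch, bigVarConv_eq_delta0, varConv_delta0]
    intro γ hγ
    rw [Finset.mem_erase, varNbr, Finset.mem_filter] at hγ
    exact hs γ hγ.2.2 hγ.1

/-! ### One butterfly -/

/-- A butterfly of the factor graph: the check `α` of degree three and the check `β` of degree
two between the nodes `L`, `L'` on the side of the input bits and `R`, `R'` on the side of the
channel. -/
structure IsButterfly (G : FactorGraph V C) (F : V → Prop) (α β : C) (L L' R R' : V) : Prop where
  nbr_left : ∀ j, j ∈ G.nbr α ↔ j = L ∨ j = R ∨ j = R'
  nbr_right : ∀ j, j ∈ G.nbr β ↔ j = L' ∨ j = R'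
  ne_check : α ≠ β
  ne_LL : L ≠ L'
  ne_LR : L ≠ R
  ne_LR' : L ≠ R'
  ne_L'R' : L' ≠ R'
  ne_RR : R ≠ R'
  ne_R_L' : R ≠ L'
  soft_R : R ∉ G.hardSource
  soft_R' : R' ∉ G.hardSource
  notF_R : ¬F R
  notF_R' : ¬F R'
  chan_L : (F L ∧ G.chan L = deltaInf) ∨ (¬F L ∧ G.chan L = delta0)
  chan_L' : (F L' ∧ G.chan L' = deltaInf) ∨ (¬F L' ∧ G.chan L' = delta0)

/-- Before the `F` functions: nothing has been sent in the butterfly. -/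
structure Stage0 (G : FactorGraph V C) (α β : C) (R R' : V) (m : Messages V C) : Prop where
  v2c_left : ∀ j, m.v2c j α = delta0
  v2c_right : ∀ j, m.v2c j β = delta0
  c2v_left : ∀ j, m.c2v α j = delta0
  c2v_right : ∀ j, m.c2v β j = delta0
  src_R : G.Sourced m R α β
  src_R' : G.Sourced m R' α β

/-- After the `F` functions and before the `G` functions. -/
structure Stage1 (G : FactorGraph V C) (α β : C) (L R R' : V) (m : Messages V C) : Prop where
  c2v_L : m.c2v α L = G.newC2V m α L
  v2c_R : m.v2c R α = G.softV2C m R α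
  v2c_R' : m.v2c R' α = G.softV2C m R' α
  v2c_right : ∀ j, m.v2c j β = delta0
  c2v_right : ∀ j, m.c2v β j = delta0
  src_R' : G.Sourced m R' α β
  info : Informative (m.c2v α L)

/-- After the `G` functions. -/
structure Stage2 (G : FactorGraph V C) (α β : C) (L' R R' : V) (m : Messages V C) : Prop where
  c2v_L' : m.c2v β L' = G.newC2V m β L'
  v2c_R' : m.v2c R' β = G.softV2C m R' β
  c2v_R' : m.c2v α R' = G.newC2V m α R'
  v2c_R : m.v2c R α = G.softV2C m R α
  info : Informative (m.c2v β L')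

/-- The check nodes on which the stage of a butterfly depends. -/
def butterflyDomain (G : FactorGraph V C) (α β : C) (R R' : V) : Set C :=
  {γ | γ = α ∨ γ = β ∨ R ∈ G.nbr γ ∨ R' ∈ G.nbr γ}

section congr

variable {α β : C} {L L' R R' : V}

theorem Stage0.congr (h : AgreeOn (G.butterflyDomain α β R R') m m')
    (hs : G.Stage0 α β R R' m) : G.Stage0 α β R R' m' where
  v2c_left j := (h α (Or.inl rfl) j).1 ▸ hs.v2c_left j
  v2c_right j := (h β (Or.inr (Or.inl rfl)) j).1 ▸ hs.v2c_right j
  c2v_left j := (h α (Or.inl rfl) j).2 ▸ hs.c2v_left j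
  c2v_right j := (h β (Or.inr (Or.inl rfl)) j).2 ▸ hs.c2v_right j
  src_R := hs.src_R.congr fun ρ hρ _ _ => (h ρ (Or.inr (Or.inr (Or.inl hρ))) R).2
  src_R' := hs.src_R'.congr fun ρ hρ _ _ => (h ρ (Or.inr (Or.inr (Or.inr hρ))) R').2

theorem newC2V_congr_left (h : AgreeOn (G.butterflyDomain α β R R') m m') (i : V) :
    G.newC2V m α i = G.newC2V m' α i := newC2V_congr fun j _ _ => (h α (Or.inl rfl) j).1

theorem newC2V_congr_right (h : AgreeOn (G.butterflyDomain α β R R') m m') (i : V) :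
    G.newC2V m β i = G.newC2V m' β i :=
  newC2V_congr fun j _ _ => (h β (Or.inr (Or.inl rfl)) j).1

theorem softV2C_congr_R (h : AgreeOn (G.butterflyDomain α β R R') m m') (γ : C) :
    G.softV2C m R γ = G.softV2C m' R γ :=
  softV2C_congr fun ρ hρ _ => (h ρ (Or.inr (Or.inr (Or.inl hρ))) R).2

theorem softV2C_congr_R' (h : AgreeOn (G.butterflyDomain α β R R') m m') (γ : C) :
    G.softV2C m R' γ = G.softV2C m' R' γ :=
  softV2C_congr fun ρ hρ _ => (h ρ (Or.inr (Or.inr (Or.inr hρ))) R').2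

theorem Stage1.congr (h : AgreeOn (G.butterflyDomain α β R R') m m')
    (hs : G.Stage1 α β L R R' m) : G.Stage1 α β L R R' m' where
  c2v_L := by rw [← (h α (Or.inl rfl) L).2, hs.c2v_L, newC2V_congr_left h]
  v2c_R := by rw [← (h α (Or.inl rfl) R).1, hs.v2c_R, softV2C_congr_R h]
  v2c_R' := by rw [← (h α (Or.inl rfl) R').1, hs.v2c_R', softV2C_congr_R' h]
  v2c_right j := (h β (Or.inr (Or.inl rfl)) j).1 ▸ hs.v2c_right j
  c2v_right j := (h β (Or.inr (Or.inl rfl)) j).2 ▸ hs.c2v_right j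
  src_R' := hs.src_R'.congr fun ρ hρ _ _ => (h ρ (Or.inr (Or.inr (Or.inr hρ))) R').2
  info := (h α (Or.inl rfl) L).2 ▸ hs.info

theorem Stage2.congr (h : AgreeOn (G.butterflyDomain α β R R') m m')
    (hs : G.Stage2 α β L' R R' m) : G.Stage2 α β L' R R' m' where
  c2v_L' := by rw [← (h β (Or.inr (Or.inl rfl)) L').2, hs.c2v_L', newC2V_congr_right h]
  v2c_R' := by rw [← (h β (Or.inr (Or.inl rfl)) R').1, hs.v2c_R', softV2C_congr_R' h]
  c2v_R' := by rw [← (h α (Or.inl rfl) R').2, hs.c2v_R', newC2V_congr_left h]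
  v2c_R := by rw [← (h α (Or.inl rfl) R).1, hs.v2c_R, softV2C_congr_R h]
  info := (h β (Or.inr (Or.inl rfl)) L').2 ▸ hs.info

end congr

/-! ### Lists of updates and the three phases of a butterfly -/

/-- Run a list of updates, marked as hard or not, and check the change of the potential. -/
def GoodRun (G : FactorGraph V C) (N : ℕ) (F : V → Prop) :
    Messages V C → List (DirEdge V C × Bool) → Prop
  | _, [] => True
  | m, e :: L => G.StepOK N F m e.1 e.2 ∧ GoodRun G N F (G.update m e.1) L

/-- The messages after a list of updates. -/
def runAll (G : FactorGraph V C) (m : Messages V C) (l : List (DirEdge V C × Bool)) :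
    Messages V C :=
  l.foldl (fun m e => G.update m e.1) m

theorem goodRun_append {l l' : List (DirEdge V C × Bool)} :
    G.GoodRun N F m (l ++ l') ↔ G.GoodRun N F m l ∧ G.GoodRun N F (G.runAll m l) l' := by
  induction l generalizing m with
  | nil => simp [GoodRun, runAll]
  | cons e l ih => simp only [List.cons_append, GoodRun, ih, and_assoc, runAll, List.foldl_cons]

theorem runAll_append {l l' : List (DirEdge V C × Bool)} :
    G.runAll m (l ++ l') = G.runAll (G.runAll m l) l' := List.foldl_append

theorem allSym_runAll (hG : ∀ i, IsSym (G.chan i)) (hm : m.AllSym)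
    (l : List (DirEdge V C × Bool)) : (G.runAll m l).AllSym := by
  induction l generalizing m with
  | nil => exact hm
  | cons e l ih => exact ih (allSym_update hG hm e.1)

theorem agreeOn_runAll {D : Set C} {l : List (DirEdge V C × Bool)}
    (h : ∀ e ∈ l, e.1.checkNode ∉ D) : AgreeOn D m (G.runAll m l) := by
  induction l generalizing m with
  | nil => exact fun _ _ _ => ⟨rfl, rfl⟩
  | cons e l ih =>
    intro γ hγ j
    have h1 := agreeOn_update (G := G) (m := m) (h e (by simp)) γ hγ j
    have h2 := ih (m := G.update m e.1) (fun e he => h e (by simp [he])) γ hγ j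
    exact ⟨h1.1.trans h2.1, h1.2.trans h2.2⟩

section blocks

variable {α β : C} {L L' R R' : V}

/-- `L` has not sent anything yet, so `α` would send Δ_0 to `R` and `R'`, as stored; hence the first
two updates are neutral. The third is the step towards the input side, with `L` silent elsewhere. -/
theorem IsButterfly.run_F (hb : G.IsButterfly F α β L L' R R') (hG : ∀ i, IsSym (G.chan i))
    (hN : 0 < N) (hm : m.AllSym) (hs : G.Stage0 α β R R' m) (hsil : G.Silent m L α) :
    G.GoodRun N F m [(.v2c R α, false), (.v2c R' α, false), (.c2v α L, false)] ∧
      G.Stage1 α β L R R'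
        (G.runAll m [(.v2c R α, false), (.v2c R' α, false), (.c2v α L, false)]) := by
  have hL : L ∈ G.nbr α := (hb.nbr_left L).2 (by simp)
  have hR : R ∈ G.nbr α := (hb.nbr_left R).2 (by simp)
  have hR' : R' ∈ G.nbr α := (hb.nbr_left R').2 (by simp)
  simp only [GoodRun, runAll, List.foldl_cons, List.foldl_nil, and_true]
  set m1 := G.update m (.v2c R α) with h1
  set m2 := G.update m1 (.v2c R' α) with h2
  set m3 := G.update m2 (.c2v α L) with h3
  have s1 : m1.AllSym := allSym_update hG hm _
  have s2 : m2.AllSym := allSym_update hG s1 _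
  -- The message Δ_0 from `L` absorbs whatever the other neighbours of `α` send.
  have zero : ∀ {m' : Messages V C} (i : V), m'.AllSym → m'.v2c L α = delta0 → L ≠ i →
      G.newC2V m' α i = delta0 := fun {m'} i hs' h hne =>
    bigCheckConv_eq_delta0 (fun j => hs'.v2c j α) (Finset.mem_erase.2 ⟨hne, hL⟩) h
  have v1 : m1.v2c L α = delta0 := by
    rw [h1, update_v2c_v2c, if_neg fun h => hb.ne_LR h.1, hs.v2c_left]
  have v2 : m2.v2c L α = delta0 := by
    rw [h2, update_v2c_v2c, if_neg fun h => hb.ne_LR' h.1, v1]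
  have r2 : m2.v2c R α = G.softV2C m R α := by
    rw [h2, update_v2c_v2c, if_neg fun h => hb.ne_RR h.1, h1, update_v2c_v2c, if_pos ⟨rfl, rfl⟩,
      newV2C_of_notMem hb.soft_R]
  have r2' : m2.v2c R' α = G.softV2C m R' α := by
    rw [h2, update_v2c_v2c, if_pos ⟨rfl, rfl⟩, newV2C_of_notMem hb.soft_R', h1,
      softV2C_update_v2c]
  have info : Informative (G.newC2V m2 α L) := by
    refine informative_bigCheckConv (fun j => s2.v2c j α) fun j hj => ?_
    rw [Finset.mem_erase, hb.nbr_left] at hj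
    rcases hj with ⟨hj, rfl | rfl | rfl⟩
    · exact absurd rfl hj
    · rw [r2]; exact hs.src_R.informative_softV2C hG hm (Or.inl rfl)
    · rw [r2']; exact hs.src_R'.informative_softV2C hG hm (Or.inl rfl)
  have hc3 : m3.c2v α L = G.newC2V m2 α L := by
    rw [h3, update_c2v_c2v, if_pos ⟨rfl, rfl⟩]
  refine ⟨⟨?_, ?_, ?_⟩, ?_⟩
  · exact stepOK_v2c hG hm (Or.inr hb.notF_R) hR
      ((hs.c2v_left R).trans (zero R hm (hs.v2c_left L) hb.ne_LR).symm)
  · exact stepOK_v2c hG s1 (Or.inr hb.notF_R') hR'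
      ((hs.c2v_left R').trans (zero R' s1 v1 hb.ne_LR').symm)
  · exact stepOK_c2v_silent hG s2 hN hb.chan_L hL v2 (hs.c2v_left L)
      ((hsil.update (Or.inr rfl)).update (Or.inr rfl)) info
  · refine ⟨?_, ?_, ?_, ?_, ?_, ?_, ?_⟩
    · exact hc3
    · rw [h3, softV2C_update_c2v fun h => absurd h.symm hb.ne_LR]
      exact r2
    · rw [h3, softV2C_update_c2v fun h => absurd h.symm hb.ne_LR']
      exact r2'
    · intro j
      rw [h3, update_c2v_v2c, h2, update_v2c_v2c, if_neg fun h => hb.ne_check h.2.symm, h1,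
        update_v2c_v2c, if_neg fun h => hb.ne_check h.2.symm, hs.v2c_right]
    · intro j
      rw [h3, update_c2v_c2v, if_neg fun h => hb.ne_check h.1.symm]
      exact hs.c2v_right j
    · exact ((hs.src_R'.update (Or.inl rfl)).update (Or.inl rfl)).update (Or.inl rfl)
    · rw [hc3]; exact info

/-- The first two updates are neutral by the equations kept in `Stage1`, the third because `L'`
still sends Δ_0 to `β`. What `L` feeds back is never inspected: the information that reaches `L'`
comes from the source of `R'`. -/
theorem IsButterfly.run_G (hb : G.IsButterfly F α β L L' R R') (hG : ∀ i, IsSym (G.chan i))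
    (hN : 0 < N) (hm : m.AllSym) (hs : G.Stage1 α β L R R' m) (hsil : G.Silent m L' β) :
    G.GoodRun N F m [(.v2c L α, true), (.c2v α R', false), (.v2c R' β, false),
        (.c2v β L', false)] ∧
      G.Stage2 α β L' R R' (G.runAll m [(.v2c L α, true), (.c2v α R', false),
        (.v2c R' β, false), (.c2v β L', false)]) := by
  have hL : L ∈ G.nbr α := (hb.nbr_left L).2 (by simp)
  have hR' : R' ∈ G.nbr α := (hb.nbr_left R').2 (by simp)
  have hL' : L' ∈ G.nbr β := (hb.nbr_right L').2 (by simp)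
  have hRb : R' ∈ G.nbr β := (hb.nbr_right R').2 (by simp)
  simp only [GoodRun, runAll, List.foldl_cons, List.foldl_nil, and_true]
  set m1 := G.update m (.v2c L α) with h1
  set m2 := G.update m1 (.c2v α R') with h2
  set m3 := G.update m2 (.v2c R' β) with h3
  set m4 := G.update m3 (.c2v β L') with h4
  have s1 : m1.AllSym := allSym_update hG hm _
  have s2 : m2.AllSym := allSym_update hG s1 _
  have s3 : m3.AllSym := allSym_update hG s2 _
  have b2 : ∀ j, m2.v2c j β = delta0 := fun j => by
    rw [h2, update_c2v_v2c, h1, update_v2c_v2c, if_neg fun h => hb.ne_check h.2.symm,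
      hs.v2c_right]
  have c2 : ∀ j, m2.c2v β j = delta0 := fun j => by
    rw [h2, update_c2v_c2v, if_neg fun h => hb.ne_check h.1.symm]
    exact hs.c2v_right j
  have a2 : m2.c2v α R' = G.newC2V m1 α R' := by
    rw [h2, update_c2v_c2v, if_pos ⟨rfl, rfl⟩]
  have r3 : m3.v2c R' β = G.softV2C m2 R' β := by
    rw [h3, update_v2c_v2c, if_pos ⟨rfl, rfl⟩, newV2C_of_notMem hb.soft_R']
  have src2 : G.Sourced m2 R' α β := (hs.src_R'.update (Or.inl rfl)).update (Or.inl rfl)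
  have info : Informative (G.newC2V m3 β L') := by
    refine informative_bigCheckConv (fun j => s3.v2c j β) fun j hj => ?_
    rw [Finset.mem_erase, hb.nbr_right] at hj
    rcases hj with ⟨hj, rfl | rfl⟩
    · exact absurd rfl hj
    · rw [r3]; exact src2.informative_softV2C hG s2 (Or.inr rfl)
  have c4 : m4.c2v β L' = G.newC2V m3 β L' := by
    rw [h4, update_c2v_c2v, if_pos ⟨rfl, rfl⟩]
  refine ⟨⟨?_, ?_, ?_, ?_⟩, ?_⟩
  · exact stepOK_v2c hG hm (Or.inl rfl) hL hs.c2v_L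
  · refine stepOK_c2v hG s1 (Or.inr hb.notF_R') hR' ?_
    rw [h1, softV2C_update_v2c, update_v2c_v2c, if_neg fun h => hb.ne_LR' h.1.symm]
    exact hs.v2c_R'
  · refine stepOK_v2c hG s2 (Or.inr hb.notF_R') hRb ?_
    rw [c2, newC2V, bigCheckConv_eq_delta0 (fun j => s2.v2c j β)
      (Finset.mem_erase.2 ⟨hb.ne_L'R', hL'⟩) (b2 L')]
  · refine stepOK_c2v_silent hG s3 hN hb.chan_L' hL' ?_ (c2 L') ?_ info
    · rw [h3, update_v2c_v2c, if_neg fun h => hb.ne_L'R' h.1, b2]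
    · have t1 := hsil.update (e := .v2c L α) (Or.inl hb.ne_LL)
      have t2 := t1.update (e := .c2v α R') (Or.inl hb.ne_L'R'.symm)
      exact t2.update (e := .v2c R' β) (Or.inr rfl)
  · refine ⟨c4, ?_, ?_, ?_, ?_⟩
    · rw [h4, softV2C_update_c2v fun h => absurd h.symm hb.ne_L'R', update_c2v_v2c, r3, h3,
        softV2C_update_v2c]
    · rw [h4, newC2V_update_c2v, update_c2v_c2v, if_neg fun h => hb.ne_check h.1, h3,
        newC2V_update_v2c fun h => absurd h hb.ne_check, update_v2c_c2v, a2, h2,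
        newC2V_update_c2v]
    · rw [h4, update_c2v_v2c, h3, update_v2c_v2c, if_neg fun h => hb.ne_check h.2, h2,
        update_c2v_v2c, h1, update_v2c_v2c, if_neg fun h => hb.ne_LR h.1.symm, hs.v2c_R]
      -- The message from `R` to `α` ignores `α`, and `R` is not adjacent to `β`, so none of the
      -- four updates affects it.
      refine softV2C_congr fun γ hγ hne => ?_
      have hne' : γ ≠ β := by
        rintro rfl
        rcases (hb.nbr_right R).1 hγ with h | h
        · exact hb.ne_R_L' h
        · exact hb.ne_RR h
      rw [update_c2v_c2v, if_neg fun h => hne' h.1, update_v2c_c2v, update_c2v_c2v,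
        if_neg fun h => hne h.1, update_v2c_c2v]
    · rw [c4]; exact info

/-- Each update overwrites a message whose opposite is current by one of the equations in `Stage2`,
and the earlier updates of the block do not enter that equation. -/
theorem IsButterfly.run_feedback (hb : G.IsButterfly F α β L L' R R')
    (hG : ∀ i, IsSym (G.chan i)) (hm : m.AllSym) (hs : G.Stage2 α β L' R R' m) :
    G.GoodRun N F m [(.v2c L' β, true), (.c2v β R', true), (.v2c R' α, true),
        (.c2v α R, true)] := by
  have hR : R ∈ G.nbr α := (hb.nbr_left R).2 (by simp)
  have hR' : R' ∈ G.nbr α := (hb.nbr_left R').2 (by simp)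
  have hL' : L' ∈ G.nbr β := (hb.nbr_right L').2 (by simp)
  have hRb : R' ∈ G.nbr β := (hb.nbr_right R').2 (by simp)
  simp only [GoodRun, and_true]
  set m1 := G.update m (.v2c L' β) with h1
  set m2 := G.update m1 (.c2v β R') with h2
  set m3 := G.update m2 (.v2c R' α) with h3
  have s1 : m1.AllSym := allSym_update hG hm _
  have s2 : m2.AllSym := allSym_update hG s1 _
  have s3 : m3.AllSym := allSym_update hG s2 _
  refine ⟨?_, ?_, ?_, ?_⟩
  · exact stepOK_v2c hG hm (Or.inl rfl) hL' hs.c2v_L'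
  · refine stepOK_c2v hG s1 (Or.inl rfl) hRb ?_
    rw [h1, update_v2c_v2c, if_neg fun h => hb.ne_L'R' h.1.symm, softV2C_update_v2c]
    exact hs.v2c_R'
  · refine stepOK_v2c hG s2 (Or.inl rfl) hR' ?_
    rw [h2, newC2V_update_c2v, update_c2v_c2v, if_neg fun h => hb.ne_check h.1, h1,
      newC2V_update_v2c fun h => absurd h hb.ne_check]
    exact hs.c2v_R'
  · refine stepOK_c2v hG s3 (Or.inl rfl) hR ?_
    rw [h3, softV2C_update_v2c, update_v2c_v2c, if_neg fun h => hb.ne_RR h.1, h2,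
      softV2C_update_c2v fun h => absurd h hb.ne_RR, update_c2v_v2c, h1, softV2C_update_v2c,
      update_v2c_v2c, if_neg fun h => hb.ne_check h.2]
    exact hs.v2c_R

end blocks

/-- Butterflies that do not interfere are passed one after the other. -/
theorem goodRun_flatMap {ι : Type} (B : ι → List (DirEdge V C × Bool))
    (P Q : ι → Messages V C → Prop) (D : ι → Set C) (hG : ∀ i, IsSym (G.chan i))
    {rows : List ι} (hnd : rows.Nodup)
    (hD : ∀ u ∈ rows, ∀ v ∈ rows, u ≠ v → ∀ e ∈ B v, e.1.checkNode ∉ D u)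
    (hP : ∀ u m m', AgreeOn (D u) m m' → P u m → P u m')
    (hQ : ∀ u m m', AgreeOn (D u) m m' → Q u m → Q u m')
    (hB : ∀ v ∈ rows, ∀ m : Messages V C, m.AllSym → P v m →
      G.GoodRun N F m (B v) ∧ Q v (G.runAll m (B v)))
    (hm : m.AllSym) (hPm : ∀ v ∈ rows, P v m) :
    G.GoodRun N F m (rows.flatMap B) ∧ ∀ v ∈ rows, Q v (G.runAll m (rows.flatMap B)) := by
  induction rows generalizing m with
  | nil => simp [GoodRun]
  | cons v rows ih =>
    rw [List.nodup_cons] at hnd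
    obtain ⟨g1, q1⟩ := hB v (by simp) m hm (hPm v (by simp))
    have hne : ∀ u ∈ rows, u ≠ v := by rintro u hu rfl; exact hnd.1 hu
    obtain ⟨g2, q2⟩ := ih hnd.2 (fun u hu w hw => hD u (by simp [hu]) w (by simp [hw]))
      (fun w hw => hB w (by simp [hw])) (allSym_runAll hG hm (B v)) fun u hu =>
        hP u _ _ (agreeOn_runAll (hD u (by simp [hu]) v (by simp) (hne u hu)))
          (hPm u (by simp [hu]))
    rw [List.flatMap_cons, goodRun_append, runAll_append]
    refine ⟨⟨g1, g2⟩, fun u hu => ?_⟩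
    rcases List.mem_cons.1 hu with rfl | hu
    · refine hQ u _ _ (agreeOn_runAll fun e he => ?_) q1
      obtain ⟨w, hw, hew⟩ := List.mem_flatMap.1 he
      exact hD u (by simp) w (by simp [hw]) (hne w hw).symm e hew
    · exact q2 u hu

end FactorGraph

open FactorGraph

/-! ### The polar factor graph -/

theorem FactorGraph.Silent.congr {V C : Type} {G : FactorGraph V C} {m m' : Messages V C} {i : V}
    {α : C} (h : AgreeOn {γ | i ∈ G.nbr γ} m m') (hs : G.Silent m i α) : G.Silent m' i α :=
  fun γ hγ hne => (h γ hγ i).2 ▸ hs γ hγ hne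

section polar

variable {s : ℕ}

/-- The words `v` and `w` agree in all positions `≥ l`. -/
def InCube (l : ℕ) (w v : Fin s → Bool) : Prop := ∀ j : Fin s, l ≤ j → v j = w j

theorem inCube_update_iff {l : ℕ} (h : l < s) {w v : Fin s → Bool} {b : Bool} :
    InCube l (Function.update w ⟨l, h⟩ b) v ↔ InCube (l + 1) w v ∧ v ⟨l, h⟩ = b := by
  constructor
  · intro hv
    refine ⟨fun j hj => ?_, by simpa using hv ⟨l, h⟩ le_rfl⟩
    have hne : j ≠ ⟨l, h⟩ := by rintro rfl; simp at hj
    rw [hv j (by omega), Function.update_of_ne hne]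
  · rintro ⟨hv, hb⟩ j hj
    by_cases hne : j = ⟨l, h⟩
    · rw [hne, Function.update_self, hb]
    · have : (j : ℕ) ≠ l := fun hh => hne (Fin.ext hh)
      rw [Function.update_of_ne hne, hv j (by omega)]

theorem mem_subcube {l : ℕ} (h : l ≤ s) {w v : Fin s → Bool} :
    v ∈ subcube l h w ↔ InCube l w v := by
  induction l generalizing w with
  | zero =>
    rw [subcube, List.mem_singleton]
    exact ⟨fun h j _ => by rw [h], fun h => funext fun j => h j (Nat.zero_le _)⟩
  | succ l ih =>
    rw [subcube, List.mem_append, ih, ih, inCube_update_iff h, inCube_update_iff h, ← and_or_left]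
    exact and_iff_left (by cases v ⟨l, h⟩ <;> simp)

theorem nodup_subcube {l : ℕ} (h : l ≤ s) (w : Fin s → Bool) : (subcube l h w).Nodup := by
  induction l generalizing w with
  | zero => simp [subcube]
  | succ l ih =>
    rw [subcube, List.nodup_append]
    refine ⟨ih _ _, ih _ _, ?_⟩
    rintro v hv u hu rfl
    rw [mem_subcube, inCube_update_iff h] at hv hu
    exact absurd (hv.2.symm.trans hu.2) (by simp)

theorem mem_polarNbr {k : Fin s} {w : Fin s → Bool} {i : VarNode s} :
    i ∈ polarNbr s (k, w) ↔ i = (k.castSucc, w) ∨ i = (k.succ, w) ∨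
      (w k = false ∧ i = (k.succ, Function.update w k true)) := by
  unfold polarNbr
  by_cases h : w k = false <;> simp [h]

variable {A : Finset (Fin s → Bool)} {c : (Fin s → Bool) → Measure EReal}

theorem isSym_polarChan (hc : ∀ k, IsSym (c k)) (i : VarNode s) :
    IsSym ((polarGraph s A c).chan i) := by
  change IsSym (polarChan s A c i)
  unfold polarChan
  split_ifs
  · exact isSym_delta0
  · exact isSym_deltaInf
  · exact hc _
  · exact isSym_delta0

theorem polarChan_castSucc (k : Fin s) (w : Fin s → Bool) :
    (IsFrozenNode A (k.castSucc, w) ∧ (polarGraph s A c).chan (k.castSucc, w) = deltaInf) ∨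
      (¬IsFrozenNode A (k.castSucc, w) ∧
        (polarGraph s A c).chan (k.castSucc, w) = delta0) := by
  change (_ ∧ polarChan s A c _ = _) ∨ (_ ∧ polarChan s A c _ = _)
  have h1 : k.castSucc ≠ Fin.last s := (Fin.castSucc_lt_last k).ne
  unfold polarChan IsFrozenNode
  by_cases h0 : k.castSucc = 0
  · by_cases hA : w ∈ A <;> simp [h0, hA]
  · simp [h0, h1]

theorem ne_update_true {k : Fin s} {v : Fin s → Bool} (hv : v k = false) :
    v ≠ Function.update v k true := by
  intro h
  have := congrFun h k
  rw [hv, Function.update_self] at this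
  exact absurd this (by simp)

theorem update_eq_update_true {k : Fin s} {u v : Fin s → Bool} (hu : u k = false)
    (hv : v k = false) (h : Function.update v k true = Function.update u k true) : v = u := by
  funext j
  by_cases hj : j = k
  · rw [hj, hu, hv]
  · simpa [hj] using congrFun h j

theorem polar_isButterfly {k : Fin s} {v : Fin s → Bool} (hv : v k = false) :
    (polarGraph s A c).IsButterfly (IsFrozenNode A) (k, v) (k, Function.update v k true)
      (k.castSucc, v) (k.castSucc, Function.update v k true)
      (k.succ, v) (k.succ, Function.update v k true) := by
  have hne := ne_update_true hv
  have hk : k.castSucc ≠ k.succ := Fin.castSucc_lt_succ.ne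
  refine ⟨?_, ?_, ?_, ?_, ?_, ?_, ?_, ?_, ?_, ?_, ?_, ?_, ?_, polarChan_castSucc k _,
    polarChan_castSucc k _⟩
  · intro j
    change j ∈ polarNbr s _ ↔ _
    rw [mem_polarNbr]
    simp [hv]
  · intro j
    change j ∈ polarNbr s _ ↔ _
    rw [mem_polarNbr]
    simp
  · simpa using hne
  · simpa using hne
  · simp [hk]
  · simp [hk]
  · simp [hk]
  · simpa using hne
  · simp [hk.symm]
  · exact Fin.succ_ne_zero k
  · exact Fin.succ_ne_zero k
  · exact fun h => Fin.succ_ne_zero k h.1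
  · exact fun h => Fin.succ_ne_zero k h.1

theorem succ_mem_polarNbr {k κ : Fin s} {v x : Fin s → Bool}
    (h : (k.succ, v) ∈ polarNbr s (κ, x)) : (κ : ℕ) = k + 1 ∨
      κ = k ∧ (x = v ∨ x k = false ∧ v = Function.update x k true) := by
  rcases mem_polarNbr.1 h with h | h | ⟨h1, h⟩ <;>
    simp only [Prod.mk.injEq, Fin.ext_iff, Fin.val_succ, Fin.val_castSucc] at h
  · exact Or.inl h.1.symm
  · obtain rfl : κ = k := Fin.ext (by omega)
    exact Or.inr ⟨rfl, Or.inl h.2.symm⟩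
  · obtain rfl : κ = k := Fin.ext (by omega)
    exact Or.inr ⟨rfl, Or.inr ⟨h1, h.2⟩⟩

/-- The nodes of layer k + 1 meet only checks of the levels k and k + 1, and at level k only the two
checks of their own butterfly. So other butterflies of the level and all deeper sub-blocks stay
outside the domain. -/
theorem polar_butterflyDomain {k : Fin s} {v : Fin s → Bool} (hv : v k = false)
    {γ : CheckNode s} (h : γ ∈ (polarGraph s A c).butterflyDomain (k, v)
      (k, Function.update v k true) (k.succ, v) (k.succ, Function.update v k true)) :
    k ≤ γ.1 ∧ (γ.1 = k → γ.2 = v ∨ γ.2 = Function.update v k true) := by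
  obtain ⟨κ, x⟩ := γ
  rcases h with h | h | h | h
  · obtain ⟨rfl, rfl⟩ := Prod.mk.injEq .. ▸ h
    exact ⟨le_rfl, fun _ => Or.inl rfl⟩
  · obtain ⟨rfl, rfl⟩ := Prod.mk.injEq .. ▸ h
    exact ⟨le_rfl, fun _ => Or.inr rfl⟩
  · rcases succ_mem_polarNbr h with h | ⟨rfl, rfl | ⟨_, h⟩⟩
    · exact ⟨Fin.le_def.2 (by simp [h]), fun hh => by
        have h' : (κ : ℕ) = k := congrArg Fin.val hh
        omega⟩
    · exact ⟨le_rfl, fun _ => Or.inl rfl⟩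
    · rw [h, Function.update_self] at hv
      exact absurd hv (by simp)
  · rcases succ_mem_polarNbr h with h | ⟨rfl, rfl | ⟨h1, h⟩⟩
    · exact ⟨Fin.le_def.2 (by simp [h]), fun hh => by
        have h' : (κ : ℕ) = k := congrArg Fin.val hh
        omega⟩
    · exact ⟨le_rfl, fun _ => Or.inr rfl⟩
    · exact ⟨le_rfl, fun _ => Or.inl (update_eq_update_true hv h1 h.symm)⟩

/-- Apart from its own check at level k, a node of layer k meets only checks on the side of the
input bits, in rows of the same sub-block; `ZeroRegion` makes these silent. -/
theorem castSucc_mem_polarNbr {k κ : Fin s} {v x : Fin s → Bool}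
    (h : (k.castSucc, v) ∈ polarNbr s (κ, x)) :
    (κ, x) = (k, v) ∨ κ < k ∧ InCube k v x := by
  rcases mem_polarNbr.1 h with h | h | ⟨h1, h⟩ <;>
    simp only [Prod.mk.injEq, Fin.ext_iff, Fin.val_succ, Fin.val_castSucc] at h
  · exact Or.inl (Prod.ext (Fin.ext h.1.symm) h.2.symm)
  · exact Or.inr ⟨Fin.lt_def.2 (by omega), fun j _ => by rw [h.2]⟩
  · refine Or.inr ⟨Fin.lt_def.2 (by omega), fun j hj => ?_⟩
    have : j ≠ κ := by rintro rfl; omega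
    rw [h.2, Function.update_of_ne this]

/-! ### Invariants of the recursion -/

/-- No message has been passed in the part of the graph on the side of the input bits of the
nodes `(l, v)`, `v ∈ subcube l w`. -/
def ZeroRegion (l : ℕ) (w : Fin s → Bool) (m : Messages (VarNode s) (CheckNode s)) : Prop :=
  ∀ γ : CheckNode s, (γ.1 : ℕ) < l → InCube l w γ.2 →
    ∀ j, m.v2c j γ = delta0 ∧ m.c2v γ j = delta0

/-- The nodes `(l, v)`, `v ∈ subcube l w`, have received information from the channel side. -/
def InformedLayer (l : ℕ) (w : Fin s → Bool) (m : Messages (VarNode s) (CheckNode s)) : Prop :=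
  ∀ v, InCube l w v → ∀ κ : Fin s, (κ : ℕ) = l → Informative (m.c2v (κ, v) (κ.castSucc, v))

theorem ZeroRegion.congr {l : ℕ} {w : Fin s → Bool} {m m' : Messages (VarNode s) (CheckNode s)}
    (h : AgreeOn {γ | (γ.1 : ℕ) < l ∧ InCube l w γ.2} m m') (hz : ZeroRegion l w m) :
    ZeroRegion l w m' := fun γ h1 h2 j =>
  ⟨(h γ ⟨h1, h2⟩ j).1 ▸ (hz γ h1 h2 j).1, (h γ ⟨h1, h2⟩ j).2 ▸ (hz γ h1 h2 j).2⟩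

theorem ZeroRegion.silent {w v : Fin s → Bool} {k : Fin s}
    {m : Messages (VarNode s) (CheckNode s)} (hz : ZeroRegion k w m) (hv : InCube k w v) :
    (polarGraph s A c).Silent m (k.castSucc, v) (k, v) := by
  rintro ⟨κ, x⟩ h hne
  rcases castSucc_mem_polarNbr h with h | ⟨h1, h2⟩
  · exact absurd h hne
  · exact (hz (κ, x) h1 (fun j hj => (h2 j hj).trans (hv j hj)) _).2

/-- On the last layer the source is the channel; on an inner layer it is the check of the next level
that `InformedLayer` speaks of. -/
theorem InformedLayer.sourced (hc : ∀ k, Informative (c k)) {w v : Fin s → Bool} {k : Fin s}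
    {m : Messages (VarNode s) (CheckNode s)} (hr : InformedLayer (k + 1) w m)
    (hv : InCube (k + 1) w v) (a b : Fin s → Bool) :
    (polarGraph s A c).Sourced m (k.succ, v) (k, a) (k, b) := by
  by_cases hk : (k : ℕ) + 1 = s
  · left
    have h1 : k.succ = Fin.last s := Fin.ext hk
    have h0 : k.succ ≠ 0 := Fin.succ_ne_zero k
    change Informative (polarChan s A c _)
    unfold polarChan
    rw [if_neg h0, if_pos h1]
    exact hc _
  · right
    have hlt : (k : ℕ) + 1 < s := by omega
    have hne : (⟨k + 1, hlt⟩ : Fin s) ≠ k := fun h => by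
      have := congrArg Fin.val h
      simp at this
    refine ⟨(⟨k + 1, hlt⟩, v), mem_polarNbr.2 (Or.inl rfl), fun h => hne (congrArg Prod.fst h),
      fun h => hne (congrArg Prod.fst h), hr v hv _ rfl⟩

/-! ### Successive cancellation -/

/-- A scheduled message as a directed edge with a mark. -/
def Scheduled.toPair (e : Scheduled s) : DirEdge (VarNode s) (CheckNode s) × Bool :=
  (e.edge, e.hard)

/-- The frame of a recursive call: it touches neither the butterflies at levels ≥ l nor the sibling
sub-block. -/
theorem checkNode_mem_scSchedule {l : ℕ} {h : l ≤ s} {w : Fin s → Bool} {e : Scheduled s}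
    (he : e ∈ scSchedule l h w) :
    (e.edge.checkNode.1 : ℕ) < l ∧ InCube l w e.edge.checkNode.2 := by
  induction l generalizing w with
  | zero => simp [scSchedule] at he
  | succ l ih =>
    have key : ∀ v ∈ subcube l (Nat.le_of_succ_le h) (Function.update w ⟨l, h⟩ false),
        InCube (l + 1) w v ∧ InCube (l + 1) w (Function.update v ⟨l, h⟩ true) := by
      intro v hv
      rw [mem_subcube, inCube_update_iff h] at hv
      refine ⟨hv.1, fun j hj => ?_⟩
      have hne : j ≠ ⟨l, h⟩ := by rintro rfl; simp at hj
      rw [Function.update_of_ne hne, hv.1 j hj]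
    have key' : ∀ b, e ∈ scSchedule l (Nat.le_of_succ_le h) (Function.update w ⟨l, h⟩ b) →
        (e.edge.checkNode.1 : ℕ) < l + 1 ∧ InCube (l + 1) w e.edge.checkNode.2 := by
      intro b hb
      obtain ⟨h1, h2⟩ := ih hb
      exact ⟨by omega, ((inCube_update_iff h).1 h2).1⟩
    simp only [scSchedule, List.mem_append, List.mem_flatMap] at he
    rcases he with (((⟨v, hv, he⟩ | he) | ⟨v, hv, he⟩) | he) | ⟨v, hv, he⟩
    · simp only [List.mem_cons, List.not_mem_nil, or_false] at he
      rcases he with rfl | rfl | rfl <;>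
        exact ⟨Nat.lt_succ_self l, (key v hv).1⟩
    · exact key' _ he
    · simp only [List.mem_cons, List.not_mem_nil, or_false] at he
      rcases he with rfl | rfl | rfl | rfl <;>
        exact ⟨Nat.lt_succ_self l, by first | exact (key v hv).1 | exact (key v hv).2⟩
    · exact key' _ he
    · simp only [List.mem_cons, List.not_mem_nil, or_false] at he
      rcases he with rfl | rfl | rfl | rfl <;>
        exact ⟨Nat.lt_succ_self l, by first | exact (key v hv).1 | exact (key v hv).2⟩

/-- Each of the three phases runs over all butterflies of the level at once. The stage reached
survives the recursive call that follows, and the messages just written supply `InformedLayer` for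
that call. -/
theorem goodRun_scSchedule (hc : ∀ k, IsSym (c k)) (hi : ∀ k, Informative (c k)) {l : ℕ}
    (h : l ≤ s) (w : Fin s → Bool) {m : Messages (VarNode s) (CheckNode s)} (hm : m.AllSym)
    (hz : ZeroRegion l w m) (hr : InformedLayer l w m) :
    (polarGraph s A c).GoodRun (2 ^ s) (IsFrozenNode A) m
      ((scSchedule l h w).map Scheduled.toPair) := by
  induction l generalizing w m with
  | zero => simp [scSchedule, GoodRun]
  | succ l ih =>
    have h0 : l ≤ s := Nat.le_of_succ_le h
    have hG := isSym_polarChan (A := A) hc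
    have hN : 0 < 2 ^ s := by positivity
    set G := polarGraph s A c with hGdef
    set k : Fin s := ⟨l, h⟩ with hk
    set up : (Fin s → Bool) → (Fin s → Bool) := fun v => Function.update v k true with hup
    set rows := subcube l h0 (Function.update w k false) with hrows
    have mem_rows : ∀ {v}, v ∈ rows ↔ InCube (l + 1) w v ∧ v k = false := fun {v} => by
      rw [hrows, mem_subcube, inCube_update_iff h]
    have up_cube : ∀ v ∈ rows, InCube (l + 1) w (up v) := fun v hv j hj => by
      have hne : j ≠ k := by rintro rfl; simp [hk] at hj
      rw [hup]
      simp only [Function.update_of_ne hne]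
      exact (mem_rows.1 hv).1 j hj
    -- As an implication, this set contains every check outside level k. It therefore covers both
    -- the butterfly domain, which reaches into level k + 1, and the checks of lower levels that
    -- matter for silence.
    set D : (Fin s → Bool) → Set (CheckNode s) :=
      fun u => {γ | γ.1 = k → γ.2 = u ∨ γ.2 = up u} with hD
    have dom : ∀ {v}, v ∈ rows →
        G.butterflyDomain (k, v) (k, up v) (k.succ, v) (k.succ, up v) ⊆ D v :=
      fun hv γ hγ => (polar_butterflyDomain (mem_rows.1 hv).2 hγ).2
    have dom' : ∀ {v}, v ∈ rows →
        G.butterflyDomain (k, v) (k, up v) (k.succ, v) (k.succ, up v) ⊆ {γ | l ≤ γ.1} :=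
      fun hv γ hγ => (polar_butterflyDomain (mem_rows.1 hv).2 hγ).1
    have disj : ∀ u ∈ rows, ∀ v ∈ rows, u ≠ v → (k, v) ∉ D u ∧ (k, up v) ∉ D u := by
      intro u hu v hv hne
      have hu' := (mem_rows.1 hu).2
      have hv' := (mem_rows.1 hv).2
      constructor
      · intro hh
        rcases hh rfl with hh | hh
        · exact hne hh.symm
        · have := congrFun hh k
          simp only [hup, hv', Function.update_self] at this
          exact absurd this (by simp)
      · intro hh
        rcases hh rfl with hh | hh
        · have := congrFun hh k
          simp only [hup, hu', Function.update_self] at this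
          exact absurd this (by simp)
        · exact hne (update_eq_update_true hu' hv' hh).symm
    set BF : (Fin s → Bool) → List (DirEdge (VarNode s) (CheckNode s) × Bool) := fun v =>
      [(.v2c (k.succ, v) (k, v), false), (.v2c (k.succ, up v) (k, v), false),
        (.c2v (k, v) (k.castSucc, v), false)] with hBF
    set BG : (Fin s → Bool) → List (DirEdge (VarNode s) (CheckNode s) × Bool) := fun v =>
      [(.v2c (k.castSucc, v) (k, v), true), (.c2v (k, v) (k.succ, up v), false),
        (.v2c (k.succ, up v) (k, up v), false),
        (.c2v (k, up v) (k.castSucc, up v), false)] with hBG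
    set BH : (Fin s → Bool) → List (DirEdge (VarNode s) (CheckNode s) × Bool) := fun v =>
      [(.v2c (k.castSucc, up v) (k, up v), true), (.c2v (k, up v) (k.succ, up v), true),
        (.v2c (k.succ, up v) (k, v), true), (.c2v (k, v) (k.succ, v), true)] with hBH
    have chkF : ∀ v, ∀ e ∈ BF v, e.1.checkNode = (k, v) ∨ e.1.checkNode = (k, up v) := by
      intro v e he
      simp only [hBF, List.mem_cons, List.not_mem_nil, or_false] at he
      rcases he with rfl | rfl | rfl <;> simp [DirEdge.checkNode]
    have chkG : ∀ v, ∀ e ∈ BG v, e.1.checkNode = (k, v) ∨ e.1.checkNode = (k, up v) := by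
      intro v e he
      simp only [hBG, List.mem_cons, List.not_mem_nil, or_false] at he
      rcases he with rfl | rfl | rfl | rfl <;> simp [DirEdge.checkNode]
    have chkH : ∀ v, ∀ e ∈ BH v, e.1.checkNode = (k, v) ∨ e.1.checkNode = (k, up v) := by
      intro v e he
      simp only [hBH, List.mem_cons, List.not_mem_nil, or_false] at he
      rcases he with rfl | rfl | rfl | rfl <;> simp [DirEdge.checkNode]
    have frameD : ∀ B : (Fin s → Bool) → List (DirEdge (VarNode s) (CheckNode s) × Bool),
        (∀ v, ∀ e ∈ B v, e.1.checkNode = (k, v) ∨ e.1.checkNode = (k, up v)) →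
        ∀ u ∈ rows, ∀ v ∈ rows, u ≠ v → ∀ e ∈ B v, e.1.checkNode ∉ D u := by
      intro B hB u hu v hv hne e he
      rcases hB v e he with hh | hh <;> rw [hh]
      · exact (disj u hu v hv hne).1
      · exact (disj u hu v hv hne).2
    have frameLt : ∀ B : (Fin s → Bool) → List (DirEdge (VarNode s) (CheckNode s) × Bool),
        (∀ v, ∀ e ∈ B v, e.1.checkNode = (k, v) ∨ e.1.checkNode = (k, up v)) →
        ∀ m : Messages (VarNode s) (CheckNode s),
          AgreeOn {γ : CheckNode s | (γ.1 : ℕ) < l} m (G.runAll m (rows.flatMap B)) := by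
      intro B hB m
      refine agreeOn_runAll fun e he => ?_
      obtain ⟨v, _, hev⟩ := List.mem_flatMap.1 he
      rcases hB v e hev with hh | hh <;> rw [hh] <;> simp [hk]
    -- The sub-block with digit b writes only at levels below l and in rows with digit b at position
    -- k.
    have frameSub : ∀ b, ∀ m : Messages (VarNode s) (CheckNode s),
        AgreeOn {γ : CheckNode s | l ≤ γ.1 ∨ γ.2 k = !b} m (G.runAll m
          ((scSchedule l h0 (Function.update w k b)).map Scheduled.toPair)) := by
      intro b m
      refine agreeOn_runAll fun e he => ?_
      obtain ⟨e', he', rfl⟩ := List.mem_map.1 he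
      obtain ⟨h1, h2⟩ := checkNode_mem_scSchedule he'
      have h3 := ((inCube_update_iff h).1 h2).2
      rintro (h4 | h4)
      · exact absurd h1 (not_lt.2 h4)
      · rw [← hk] at h3
        exact absurd ((h3.symm.trans h4 : b = !b)) (by cases b <;> simp)
    have zsub : ∀ b, ZeroRegion l (Function.update w k b) m := fun b γ h1 h2 =>
      hz γ (by omega) ((inCube_update_iff h).1 h2).1
    have hs0 : ∀ v ∈ rows, G.Stage0 (k, v) (k, up v) (k.succ, v) (k.succ, up v) m := by
      intro v hv
      have hv' := (mem_rows.1 hv).1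
      have z1 := hz (k, v) (Nat.lt_succ_self l) hv'
      have z2 := hz (k, up v) (Nat.lt_succ_self l) (up_cube v hv)
      exact ⟨fun j => (z1 j).1, fun j => (z2 j).1, fun j => (z1 j).2, fun j => (z2 j).2,
        InformedLayer.sourced (k := k) hi hr hv' _ _,
        InformedLayer.sourced (k := k) hi hr (up_cube v hv) _ _⟩
    have cube0 : ∀ v ∈ rows, InCube k (Function.update w k false) v := fun v hv =>
      (inCube_update_iff h).2 (mem_rows.1 hv)
    have cube1 : ∀ v ∈ rows, InCube k (Function.update w k true) (up v) := fun v hv =>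
      (inCube_update_iff h).2 ⟨up_cube v hv, by simp [hup, hk]⟩
    have silD : ∀ u x m m', (x = u ∨ x = up u) → AgreeOn (D u) m m' →
        G.Silent m (k.castSucc, x) (k, x) → G.Silent m' (k.castSucc, x) (k, x) := by
      intro u x m m' hx ha hsil
      refine hsil.congr (ha.mono ?_)
      rintro ⟨κ, y⟩ hy
      rcases castSucc_mem_polarNbr hy with hh | ⟨hh, _⟩
      · obtain ⟨rfl, rfl⟩ := Prod.mk.injEq .. ▸ hh
        exact fun _ => hx
      · exact fun h' => absurd h' hh.ne
    obtain ⟨g1, st1⟩ := goodRun_flatMap (G := G) (N := 2 ^ s) (F := IsFrozenNode A) BF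
      (fun v m => v ∈ rows ∧ G.Stage0 (k, v) (k, up v) (k.succ, v) (k.succ, up v) m ∧
        G.Silent m (k.castSucc, v) (k, v))
      (fun v m => v ∈ rows ∧
        G.Stage1 (k, v) (k, up v) (k.castSucc, v) (k.succ, v) (k.succ, up v) m)
      D hG (nodup_subcube h0 _) (frameD BF chkF)
      (fun u m m' ha hP => ⟨hP.1, hP.2.1.congr (ha.mono (dom hP.1)),
        silD u u m m' (Or.inl rfl) ha hP.2.2⟩)
      (fun u m m' ha hQ => ⟨hQ.1, hQ.2.congr (ha.mono (dom hQ.1))⟩)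
      (fun v hv m hm hP => by
        have := (polar_isButterfly (mem_rows.1 hv).2).run_F hG hN hm hP.2.1 hP.2.2
        exact ⟨this.1, hv, this.2⟩)
      hm (fun v hv => ⟨hv, hs0 v hv, (zsub false).silent (k := k) (cube0 v hv)⟩)
    set m1 := G.runAll m (rows.flatMap BF) with hm1
    have s1 : m1.AllSym := allSym_runAll hG hm _
    have z1 : ∀ b, ZeroRegion l (Function.update w k b) m1 := fun b =>
      (zsub b).congr ((frameLt BF chkF m).mono fun _ hγ => hγ.1)
    have g2 := ih h0 (Function.update w k false) s1 (z1 false) (by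
      intro v hv κ hκ
      obtain rfl : κ = k := Fin.ext hκ
      exact (st1 v (mem_rows.2 ((inCube_update_iff h).1 hv))).2.info)
    set m2 := G.runAll m1 ((scSchedule l h0 (Function.update w k false)).map Scheduled.toPair)
      with hm2
    have s2 : m2.AllSym := allSym_runAll hG s1 _
    have z2 : ZeroRegion l (Function.update w k true) m2 :=
      (z1 true).congr ((frameSub false m1).mono fun γ hγ =>
        Or.inr ((inCube_update_iff h).1 hγ.2).2)
    obtain ⟨g3, st3⟩ := goodRun_flatMap (G := G) (N := 2 ^ s) (F := IsFrozenNode A) BG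
      (fun v m => v ∈ rows ∧
        G.Stage1 (k, v) (k, up v) (k.castSucc, v) (k.succ, v) (k.succ, up v) m ∧
        G.Silent m (k.castSucc, up v) (k, up v))
      (fun v m => v ∈ rows ∧
        G.Stage2 (k, v) (k, up v) (k.castSucc, up v) (k.succ, v) (k.succ, up v) m)
      D hG (nodup_subcube h0 _) (frameD BG chkG)
      (fun u m m' ha hP => ⟨hP.1, hP.2.1.congr (ha.mono (dom hP.1)),
        silD u (up u) m m' (Or.inr rfl) ha hP.2.2⟩)
      (fun u m m' ha hQ => ⟨hQ.1, hQ.2.congr (ha.mono (dom hQ.1))⟩)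
      (fun v hv m hm hP => by
        have := (polar_isButterfly (mem_rows.1 hv).2).run_G hG hN hm hP.2.1 hP.2.2
        exact ⟨this.1, hv, this.2⟩)
      s2 (fun v hv => ⟨hv, (st1 v hv).2.congr ((frameSub false m1).mono fun γ hγ =>
        Or.inl (dom' hv hγ)), z2.silent (k := k) (cube1 v hv)⟩)
    set m3 := G.runAll m2 (rows.flatMap BG) with hm3
    have s3 : m3.AllSym := allSym_runAll hG s2 _
    have z3 : ZeroRegion l (Function.update w k true) m3 :=
      z2.congr ((frameLt BG chkG m2).mono fun _ hγ => hγ.1)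
    have g4 := ih h0 (Function.update w k true) s3 z3 (by
      intro v hv κ hκ
      obtain rfl : κ = k := Fin.ext hκ
      obtain ⟨hv1, hv2⟩ := (inCube_update_iff h).1 hv
      -- The butterflies are indexed by their row with digit 0, so the stage of the row `v` is found
      -- under its partner.
      have hv3 : Function.update v k false ∈ rows := mem_rows.2 ⟨fun j hj => by
        have hne : j ≠ k := by rintro rfl; simp [hk] at hj
        rw [Function.update_of_ne hne, hv1 j hj], by simp⟩
      have hv4 : up (Function.update v k false) = v := by
        simp only [hup, Function.update_idem]
        rw [← hv2]
        exact Function.update_eq_self _ _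
      have := (st3 _ hv3).2.info
      rwa [hv4] at this)
    set m4 := G.runAll m3 ((scSchedule l h0 (Function.update w k true)).map Scheduled.toPair)
      with hm4
    have s4 : m4.AllSym := allSym_runAll hG s3 _
    obtain ⟨g5, -⟩ := goodRun_flatMap (G := G) (N := 2 ^ s) (F := IsFrozenNode A) BH
      (fun v m => v ∈ rows ∧
        G.Stage2 (k, v) (k, up v) (k.castSucc, up v) (k.succ, v) (k.succ, up v) m)
      (fun _ _ => True)
      D hG (nodup_subcube h0 _) (frameD BH chkH)
      (fun u m m' ha hP => ⟨hP.1, hP.2.congr (ha.mono (dom hP.1))⟩)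
      (fun _ _ _ _ _ => trivial)
      (fun v hv m hm hP =>
        ⟨(polar_isButterfly (mem_rows.1 hv).2).run_feedback hG hm hP.2, trivial⟩)
      s4 (fun v hv => ⟨hv, (st3 v hv).2.congr ((frameSub true m3).mono fun γ hγ =>
        Or.inl (dom' hv hγ))⟩)
    have hmap : (scSchedule (l + 1) h w).map Scheduled.toPair =
        rows.flatMap BF ++
          (scSchedule l h0 (Function.update w k false)).map Scheduled.toPair ++
          rows.flatMap BG ++
          (scSchedule l h0 (Function.update w k true)).map Scheduled.toPair ++
          rows.flatMap BH := by
      simp only [scSchedule, List.map_append, List.map_flatMap]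
      rfl
    rw [hmap]
    simp only [goodRun_append, runAll_append]
    exact ⟨⟨⟨⟨g1, g2⟩, g3⟩, g4⟩, g5⟩

/-! ### From runs to steps -/

/-- `run` with counter 0 still executes the leading hard messages; as these preserve the potential,
the change between two values of the counter is that of the counted update alone. -/
theorem FactorGraph.GoodRun.potential_run_zero
    {G : FactorGraph (VarNode s) (CheckNode s)} {N : ℕ} {F : VarNode s → Prop}
    {L : List (Scheduled s)} {m : Messages (VarNode s) (CheckNode s)}
    (h : G.GoodRun N F m (L.map Scheduled.toPair)) :
    G.potential N (run G L 0 m) = G.potential N m := by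
  induction L generalizing m with
  | nil => rfl
  | cons e L ih =>
    obtain ⟨e, hard⟩ := e
    cases hard with
    | true => exact (ih h.2).trans (h.1.2 (by simp [Scheduled.toPair]))
    | false => rfl

theorem FactorGraph.GoodRun.potential_run_lt_iff
    {G : FactorGraph (VarNode s) (CheckNode s)} {N : ℕ} {F : VarNode s → Prop}
    {L : List (Scheduled s)} {m : Messages (VarNode s) (CheckNode s)}
    (h : G.GoodRun N F m (L.map Scheduled.toPair)) {t : ℕ}
    (ht : t < ((L.filter (fun e : Scheduled s => !e.hard)).map (fun e : Scheduled s => e.edge)).length) :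
    G.potential N (run G L (t + 1) m) < G.potential N (run G L t m) ↔
      F (((L.filter (fun e : Scheduled s => !e.hard)).map (fun e : Scheduled s => e.edge))[t]).varNode := by
  induction L generalizing m t with
  | nil => simp at ht
  | cons e L ih =>
    obtain ⟨e, hard⟩ := e
    cases hard with
    | true => exact ih h.2 ht
    | false =>
      cases t with
      | zero =>
        change G.potential N (run G L 0 (G.update m e)) < G.potential N m ↔ F e.varNode
        have hz : G.potential N (run G L 0 (G.update m e)) = G.potential N (G.update m e) :=
          GoodRun.potential_run_zero h.2
        rw [hz]
        refine ⟨fun hlt => ?_, fun hF => h.1.1 ⟨rfl, hF⟩⟩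
        by_contra hF
        exact hlt.ne (h.1.2 fun hh => hF hh.2)
      | succ t => exact ih h.2 (by simpa using ht)

end polar

end PolarGap

end

theorem mainTheorem4 (s : ℕ) (A : Finset (Fin s → Bool))
    (c : (Fin s → Bool) → MeasureTheory.Measure EReal)
    (hc : ∀ k, PolarGap.IsLDensity (c k)) (hc0 : ∀ k, c k ≠ PolarGap.delta0)
    (t : ℕ) (ht : t < (PolarGap.scSteps s).length) :
    PolarGap.gap A c (t + 1) < PolarGap.gap A c t ↔
      PolarGap.IsFrozenNode A ((PolarGap.scSteps s)[t]).varNode := by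
  have hs : ∀ k, PolarGap.IsSym (c k) := fun k => (hc k).isSym
  have hi : ∀ k, PolarGap.Informative (c k) := fun k => by
    by_contra h
    exact hc0 k ((hs k).eq_delta0_of_not_informative h)
  refine (PolarGap.goodRun_scSchedule hs hi le_rfl (fun _ => false)
    (m := PolarGap.Messages.init _ _)
    ⟨fun _ _ => PolarGap.isSym_delta0, fun _ _ => PolarGap.isSym_delta0⟩
    (fun _ _ _ _ => ⟨rfl, rfl⟩) fun _ _ κ hκ => ?_).potential_run_lt_iff ht
  -- No check lies beyond layer s, so `InformedLayer` is vacuous at the top level.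
  exact absurd κ.isLt (by omega)
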